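/- For a family $\mathcal H$ of graphs and integers $t,n$, let $\mathrm{ex}_t(n,\mathcal H)$ be the largest integer $e$ for which there are graphs $G_1,\dots,G_t$ on a common set of $n$ vertices, each with at least $e$ edges, that contain no rainbow copy of a member of $\mathcal H$; a copy of $H$ is rainbow if one can choose for each edge $uv$ of the copy an index $i$ with $uv\in E(G_i)$ such that distinct edges get distinct indices. Let $M_{s+1}$ be the matching with $s+1$ edges. For a finite graph $F$, let $\mathcal F(F)$ be the family of graphs obtained from $F$ by deleting the vertices of an independent set. For an integer $k\ge 0$, let $\mathcal F[k]=\{K_{k+1}\}$ if $F$ has no vertex cover of size at most $k$, and otherwise let $\mathcal F[k]$ be the family of the induced subgraphs $F[S]$, where $S$ is a vertex cover of $F$ with $|S|\le k$. If $F$ is bipartite, let $p=p(F)$ be the smallest possible order of a colour class in a proper two-colouring of $F$. **Theorem.** Let $F$ be a finite graph, let $s\ge 0$ and $t\ge\max\{|E(F)|,s+1\}$ be integers. (i) If $F$ is not bipartite and $n$ is sufficiently large (in terms of $F,s,t$), then $\mathrm{ex}_t(n,\{F,M_{s+1}\})=s(n-s)+\mathrm{ex}_t(s,\mathcal F(F))$.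 (ii) If $F$ is bipartite, $p(F)>s$ and $n$ is sufficiently large (in terms of $F,s,t$), then $\mathrm{ex}_t(n,\{F,M_{s+1}\})=s(n-s)+\mathrm{ex}_t(s,\mathcal F[s])$. (iii) If $F$ is bipartite with at least one edge, $p(F)\le s$ and $t$ is sufficiently large (in terms of $F,s$), then $\mathrm{ex}_t(n,\{F,M_{s+1}\})=(p-1)n+O(1)$ for all $n\ge 0$, where the implied constant depends only on $F$ and $s$. (iv) Assume that $F$ is a balanced tree, i.e. a tree with $|V(F)|=2p(F)$, and that the Erdős–Sós conjecture holds for $F$, i.e. every $n$-vertex graph that does not contain $F$ has at most $(|V(F)|-2)n/2$ edges, for every $n$. If $p(F)\le s$, $t$ is sufficiently large (in terms of $F,s$) and $n$ is sufficiently large (in terms of $F,s,t$), then $\mathrm{ex}_t(n,\{F,M_{s+1}\})=(p-1)(n-p+1)+\mathrm{ex}_t(p-1,\mathcal F[p-1])$. In particular, all the extremal numbers in (i)–(iv) exist. -/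

import Mathlib

namespace RainbowTuran

/-- A family of graphs: a set of graphs on arbitrary vertex types. -/
abbrev GraphFamily : Type 1 := Set (Σ V : Type, SimpleGraph V)

/-- The collection `G 0, …, G (t - 1)` on the common vertex set `V` contains a rainbow copy of `H`:
there are an injection `φ` of the vertices of `H` into `V` and an injective assignment `c` of
colours to the edges of `H`, such that the image of each edge `e` is an edge of `G (c e)`. -/
def HasRainbowCopy {t : ℕ} {V W : Type} (G : Fin t → SimpleGraph V) (H : SimpleGraph W) : Prop :=
  ∃ (φ : W ↪ V) (c : H.edgeSet ↪ Fin t),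
    ∀ e : H.edgeSet, Sym2.map φ (e : Sym2 W) ∈ (G (c e)).edgeSet

/-- The collection contains no rainbow copy of any member of the family. -/
def RainbowFree {t : ℕ} {V : Type} (G : Fin t → SimpleGraph V) (𝓗 : GraphFamily) : Prop :=
  ∀ H ∈ 𝓗, ¬ HasRainbowCopy G H.2

/-- `IsRainbowEx t n 𝓗 e` says that `ex_t(n, 𝓗)` exists and equals `e`: `e` is the largest integer
such that some rainbow `𝓗`-free collection of `t` graphs on `n` vertices has at least `e` edges in
each of its graphs. -/
def IsRainbowEx (t n : ℕ) (𝓗 : GraphFamily) (e : ℕ) : Prop :=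
  IsGreatest {k : ℕ | ∃ G : Fin t → SimpleGraph (Fin n),
    RainbowFree G 𝓗 ∧ ∀ i, k ≤ (G i).edgeSet.ncard} e

/-- The matching `M_m`, with `m` pairwise disjoint edges (and no further vertices). -/
def matching (m : ℕ) : SimpleGraph (Fin m × Bool) where
  Adj x y := x.1 = y.1 ∧ x.2 ≠ y.2
  symm := ⟨fun _ _ h => ⟨h.1.symm, h.2.symm⟩⟩
  loopless := ⟨fun _ h => h.2 rfl⟩

/-- The family `{F, M_{s+1}}`. -/
def withMatching {W : Type} (F : SimpleGraph W) (s : ℕ) : GraphFamily :=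
  {⟨W, F⟩, ⟨Fin (s + 1) × Bool, matching (s + 1)⟩}

/-- `𝓕(F)`: the graphs obtained from `F` by deleting the vertices of an independent set. -/
def deleteIndep {W : Type} (F : SimpleGraph W) : GraphFamily :=
  {H | ∃ I : Set W, F.IsIndepSet I ∧ H = ⟨↥(Iᶜ), F.induce Iᶜ⟩}

open Classical in
/-- `𝓕[p]`: the subgraphs of `F` induced by its vertex covers of size at most `p` if there are any
such covers, and `{K_{p+1}}` otherwise. -/
def coverFamily {W : Type} (F : SimpleGraph W) (p : ℕ) : GraphFamily :=
  if ∃ S : Set W, F.IsVertexCover S ∧ S.encard ≤ p then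
    {H | ∃ S : Set W, F.IsVertexCover S ∧ S.encard ≤ p ∧ H = ⟨↥S, F.induce S⟩}
  else {⟨Fin (p + 1), ⊤⟩}

/-- `p(F)`: the smallest possible order of a colour class in a proper two-colouring of `F`
(meaningful for bipartite `F`; by swapping the colours it suffices to look at one class). -/
noncomputable def minColorClass {W : Type} (F : SimpleGraph W) : ℕ :=
  sInf {k : ℕ | ∃ c : F.Coloring Bool, k = {w : W | c w = true}.ncard}

/-- The Erdős–Sós conjecture holds for `F`: `ex(n, F) ≤ (|V(F)| - 2) n / 2` for every `n`. -/
def ErdosSosHolds {W : Type} (F : SimpleGraph W) : Prop :=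
  ∀ n : ℕ, (SimpleGraph.extremalNumber n F : ℝ) ≤ ((Nat.card W : ℝ) - 2) * n / 2

end RainbowTuran

namespace RainbowTuran
-- For the lower bounds, put `k = s` in (i) and (ii) and `k = p - 1` in (iii) and (iv). Take a
-- collection on `k` vertices that is free of the graphs `F` minus an independent set, and join all
-- its graphs completely to the same independent set. A rainbow `F` would leave such a graph on the
-- core, and the `k ≤ s` core vertices cover all edges, so there is no rainbow `M_{s+1}`
-- (`exists_collection_of_deleteIndep`). The family `𝓕[k]` imposes the same condition on `k`
-- vertices (`rainbowFree_coverFamily`).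
--
-- For the upper bounds in (i) and (ii), greedy choices and Hall's theorem show that dense graphs
-- without a rainbow `M_{s+1}` share a cover `A` of exactly `s` vertices (`exists_common_cover`). If
-- every graph has too many edges, each has more than `ex_t(s, 𝓕(F))` edges inside `A`, so `A`
-- carries a rainbow copy of `F` minus an independent set. All but boundedly many outside vertices
-- are joined to all of `A` in every colour, and they complete the copy (`HasRainbowCopy.extend`).
--
-- If `p ≤ s`, boundedly many colours can be deleted so that the remaining graphs have a bounded
-- common cover `Z` and no vertex outside `Z` is the centre of a rainbow star with `p` edges:
-- otherwise many colour-disjoint stars would share their leaves and contain `F`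
-- (`exists_cover_not_hasRainbowStar`). With many colours, such a vertex has on average at most `q =
-- p - 1` neighbours in `Z` (`sum_card_nbrsIn_le_of_not_hasRainbowStar`). Averaging over the colours
-- gives (iii).
--
-- For (iv), keep many colours that agree on `Z`. The equality case of the star bound yields a
-- `q`-set `H` in `Z` joined in all these colours to many outside vertices. Their common graph
-- contains no `F`, which leaves at most `ex_t(q, 𝓕(F))` edges inside `H`. By a tree embedding and
-- the Erdős–Sós hypothesis, the rest of `Z` contributes at most `q` edges per vertex
-- (`card_edgesIn_le_of_isTree`).
open scoped Classical in
/-- The edges of `G` with both ends in `A`. -/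
noncomputable def edgesIn {V : Type} [Fintype V] (G : SimpleGraph V) (A : Finset V) :
    Finset (Sym2 V) :=
  Finset.univ.filter fun e => e ∈ G.edgeSet ∧ ∀ x ∈ e, x ∈ A

open scoped Classical in
/-- The neighbours of `u` in `A`. -/
noncomputable def nbrsIn {V : Type} (G : SimpleGraph V) (A : Finset V) (u : V) : Finset V :=
  A.filter fun v => G.Adj u v

/-- `Z` meets every edge of `G`. -/
def Covers {V : Type} (G : SimpleGraph V) (Z : Finset V) : Prop :=
  ∀ a b, G.Adj a b → a ∈ Z ∨ b ∈ Z

/-- Every independent vertex cover of `F` has more than `k` vertices. -/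
def NoIndepCover {W : Type} (F : SimpleGraph W) (k : ℕ) : Prop :=
  ∀ S : Set W, F.IsIndepSet S → F.IsIndepSet Sᶜ → k < S.ncard

section
open scoped Classical

variable {V W : Type}

/-! ### Counting edges through a cover -/

@[simp] lemma mem_nbrsIn {G : SimpleGraph V} {A : Finset V} {u v : V} :
    v ∈ nbrsIn G A u ↔ v ∈ A ∧ G.Adj u v := by
  simp [nbrsIn]

@[simp] lemma mk_mem_edgesIn [Fintype V] {G : SimpleGraph V} {A : Finset V} {a b : V} :
    s(a, b) ∈ edgesIn G A ↔ G.Adj a b ∧ a ∈ A ∧ b ∈ A := by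
  simp [edgesIn]

lemma edgesIn_univ [Fintype V] (G : SimpleGraph V) :
    (edgesIn G Finset.univ).card = G.edgeSet.ncard := by
  rw [← Set.ncard_coe_finset]
  congr 1
  ext e
  simp [edgesIn]

lemma card_edgesIn_le_sq [Fintype V] (G : SimpleGraph V) (A : Finset V) :
    (edgesIn G A).card ≤ A.card ^ 2 := by
  have h : edgesIn G A ⊆ (A ×ˢ A).image fun x => s(x.1, x.2) := by
    intro e
    induction e with | _ a b =>
    intro h
    rw [mk_mem_edgesIn] at h
    exact Finset.mem_image.2 ⟨(a, b), by simp [h.2.1, h.2.2], rfl⟩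
  calc _ ≤ _ := Finset.card_le_card h
    _ ≤ _ := Finset.card_image_le
    _ = _ := by rw [Finset.card_product, sq]

lemma card_edgesIn_range [Fintype V] {X : Type} [Fintype X] (G : SimpleGraph V) (f : X ↪ V) :
    (edgesIn G (Finset.univ.map f)).card = (G.comap f).edgeSet.ncard := by
  rw [← Set.ncard_image_of_injective _ (Sym2.map.injective f.injective), ← Set.ncard_coe_finset]
  congr 1
  ext e
  induction e with | _ a b =>
  rw [Finset.mem_coe, mk_mem_edgesIn]
  constructor
  · rintro ⟨h, ha, hb⟩
    simp only [Finset.mem_map, Finset.mem_univ, true_and] at ha hb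
    obtain ⟨x, rfl⟩ := ha
    obtain ⟨y, rfl⟩ := hb
    exact ⟨s(x, y), h, rfl⟩
  · rintro ⟨e, he, h⟩
    induction e with | _ x y =>
    rw [SimpleGraph.mem_edgeSet, SimpleGraph.comap_adj] at he
    rw [Sym2.map_mk, Sym2.eq_iff] at h
    rcases h with ⟨rfl, rfl⟩ | ⟨rfl, rfl⟩
    · exact ⟨he, by simp, by simp⟩
    · exact ⟨he.symm, by simp, by simp⟩

/-- Edges that meet `R` in at least one vertex and otherwise lie in `A` or `B`. -/
lemma card_edgesIn_le_of_split [Fintype V] (G : SimpleGraph V) (Z A R B : Finset V)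
    (h : ∀ a ∈ Z, ∀ b ∈ Z, G.Adj a b → a ∉ R → b ∉ R → (a ∈ A ∧ b ∈ A) ∨ (a ∈ B ∧ b ∈ B)) :
    (edgesIn G Z).card ≤
      (edgesIn G A).card + ∑ y ∈ R, (nbrsIn G Z y).card + (edgesIn G B).card := by
  have hsub : edgesIn G Z ⊆
      edgesIn G A ∪ (R.sigma fun y => nbrsIn G Z y).image (fun x => s(x.1, x.2)) ∪ edgesIn G B := by
    intro e
    induction e with | _ a b =>
    intro he
    rw [mk_mem_edgesIn] at he
    obtain ⟨hab, ha, hb⟩ := he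
    simp only [Finset.mem_union, mk_mem_edgesIn, Finset.mem_image, Finset.mem_sigma, mem_nbrsIn]
    by_cases haR : a ∈ R
    · exact Or.inl (Or.inr ⟨⟨a, b⟩, ⟨haR, hb, hab⟩, rfl⟩)
    by_cases hbR : b ∈ R
    · exact Or.inl (Or.inr ⟨⟨b, a⟩, ⟨hbR, ha, hab.symm⟩, Sym2.eq_swap⟩)
    rcases h a ha b hb hab haR hbR with h | h
    · exact Or.inl (Or.inl ⟨hab, h⟩)
    · exact Or.inr ⟨hab, h⟩
  refine (Finset.card_le_card hsub).trans ((Finset.card_union_le _ _).trans ?_)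
  gcongr
  refine (Finset.card_union_le _ _).trans ?_
  gcongr
  exact Finset.card_image_le.trans (Finset.card_sigma _ _).le

lemma ncard_edgeSet_le_of_covers [Fintype V] {G : SimpleGraph V} {Z : Finset V} (h : Covers G Z) :
    G.edgeSet.ncard ≤ ∑ u ∈ Zᶜ, (nbrsIn G Z u).card + (edgesIn G Z).card := by
  rw [← Set.ncard_coe_finset (edgesIn G Z), ← Finset.card_sigma]
  have hsub : G.edgeSet ⊆
      ((Zᶜ.sigma fun u => nbrsIn G Z u).image (fun x => s(x.1, x.2)) : Set (Sym2 V)) ∪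
        (edgesIn G Z : Set (Sym2 V)) := by
    intro e
    induction e with | _ a b =>
    intro hab
    rw [SimpleGraph.mem_edgeSet] at hab
    simp only [Set.mem_union, Finset.mem_coe, mk_mem_edgesIn, Finset.mem_image, Finset.mem_sigma,
      mem_nbrsIn, Finset.mem_compl]
    by_cases ha : a ∈ Z
    · by_cases hb : b ∈ Z
      · exact Or.inr ⟨hab, ha, hb⟩
      · exact Or.inl ⟨⟨b, a⟩, ⟨hb, ha, hab.symm⟩, Sym2.eq_swap⟩
    · exact Or.inl ⟨⟨a, b⟩, ⟨ha, (h a b hab).resolve_left ha, hab⟩, rfl⟩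
  refine (Set.ncard_le_ncard hsub (Set.toFinite _)).trans ((Set.ncard_union_le _ _).trans ?_)
  gcongr
  rw [Set.ncard_coe_finset]
  exact Finset.card_image_le

/-- Counting edges at a cover by degrees. -/
lemma ncard_edgeSet_le_sum_degree [Fintype V] {G : SimpleGraph V} {Z : Finset V}
    (h : Covers G Z) :
    G.edgeSet.ncard ≤ ∑ u ∈ Z, (nbrsIn G Finset.univ u).card := by
  rw [← edgesIn_univ]
  refine (card_edgesIn_le_of_split G Finset.univ ∅ Z ∅ ?_).trans ?_
  · intro a _ b _ hab ha hb
    exact absurd (h a b hab) (by simp [ha, hb])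
  · have h0 : edgesIn G (∅ : Finset V) = ∅ := by
      ext e
      induction e with | _ a b => simp
    simp [h0]

/-! ### Rainbow copies -/

lemma hasRainbowCopy_of_coloring {t : ℕ} {G : Fin t → SimpleGraph V} {H : SimpleGraph W}
    (φ : W ↪ V) (κ : Sym2 W → Fin t) (hκ : Set.InjOn κ H.edgeSet)
    (h : ∀ x y, H.Adj x y → (G (κ s(x, y))).Adj (φ x) (φ y)) : HasRainbowCopy G H := by
  refine ⟨φ, ⟨fun e => κ e, fun e e' he => Subtype.ext (hκ e.2 e'.2 he)⟩, ?_⟩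
  rintro ⟨e, he⟩
  induction e with | _ a b => exact h a b he

lemma HasRainbowCopy.exists_coloring {t : ℕ} {G : Fin t → SimpleGraph V} {H : SimpleGraph W}
    (h : HasRainbowCopy G H) : ∃ (φ : W ↪ V) (κ : H.edgeSet → Fin t), Function.Injective κ ∧
      ∀ x y (hxy : H.Adj x y), (G (κ ⟨s(x, y), hxy⟩)).Adj (φ x) (φ y) := by
  obtain ⟨φ, c, hc⟩ := h
  exact ⟨φ, c, c.injective, fun x y hxy => hc ⟨s(x, y), hxy⟩⟩

lemma HasRainbowCopy.map {t : ℕ} {V' : Type} {G : Fin t → SimpleGraph V}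
    {G' : Fin t → SimpleGraph V'} {H : SimpleGraph W} (h : HasRainbowCopy G H) (f : V ↪ V')
    (hf : ∀ i a b, (G i).Adj a b → (G' i).Adj (f a) (f b)) : HasRainbowCopy G' H := by
  obtain ⟨φ, κ, hκ, h⟩ := h.exists_coloring
  refine ⟨φ.trans f, ⟨κ, hκ⟩, ?_⟩
  rintro ⟨e, he⟩
  induction e with | _ a b => exact hf _ _ _ (h a b he)

/-- If the edges in `E₀` carry distinct admissible colours and every other edge admits all the
colours of a large set `I`, then there is a rainbow copy. -/
lemma hasRainbowCopy_of_partial [Finite W] {t : ℕ} {G : Fin t → SimpleGraph V} {H : SimpleGraph W}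
    (φ : W ↪ V) (E₀ : Set (Sym2 W)) (hE : E₀ ⊆ H.edgeSet) (κ : E₀ → Fin t)
    (hκ : Function.Injective κ) (I : Finset (Fin t)) (hI : H.edgeSet.ncard ≤ I.card)
    (h₀ : ∀ x y (h : s(x, y) ∈ E₀), (G (κ ⟨s(x, y), h⟩)).Adj (φ x) (φ y))
    (h₁ : ∀ x y, H.Adj x y → s(x, y) ∉ E₀ → ∀ i ∈ I, (G i).Adj (φ x) (φ y)) :
    HasRainbowCopy G H := by
  have := Fintype.ofFinite W
  set J : Finset (Fin t) := I \ Finset.univ.image κ with hJ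
  -- At most one colour of `I` is lost for each edge already coloured, so enough remain for the
  -- other edges.
  have hcard : Fintype.card ↥(H.edgeSet \ E₀) ≤ Fintype.card J := by
    have h1 : Fintype.card ↥(H.edgeSet \ E₀) = H.edgeSet.ncard - E₀.ncard := by
      rw [← Set.ncard_sdiff hE, Set.ncard_eq_toFinset_card', Set.toFinset_card]
    have h2 : (Finset.univ.image κ).card ≤ E₀.ncard := by
      refine Finset.card_image_le.trans ?_
      rw [Finset.card_univ, Set.ncard_eq_toFinset_card', Set.toFinset_card]
    have h3 : I.card - (Finset.univ.image κ).card ≤ J.card := Finset.le_card_sdiff _ _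
    rw [h1, Fintype.card_coe]
    omega
  obtain ⟨g⟩ := Function.Embedding.nonempty_of_card_le hcard
  refine ⟨φ, ⟨fun e => if h : e.1 ∈ E₀ then κ ⟨e.1, h⟩ else g ⟨e.1, e.2, h⟩, ?_⟩, ?_⟩
  · intro e e' hee
    by_cases h : e.1 ∈ E₀ <;> by_cases h' : e'.1 ∈ E₀
    · simp only [h, h', dif_pos] at hee
      exact Subtype.ext ((Subtype.ext_iff.1 (hκ hee) :))
    · simp only [h, h', dif_pos, dif_neg, not_false_eq_true] at hee
      have := (g ⟨e'.1, e'.2, h'⟩).2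
      rw [← hee] at this
      simp [hJ] at this
    · simp only [h, h', dif_pos, dif_neg, not_false_eq_true] at hee
      have := (g ⟨e.1, e.2, h⟩).2
      rw [hee] at this
      simp [hJ] at this
    · simp only [h, h', dif_neg, not_false_eq_true] at hee
      exact Subtype.ext (Subtype.ext_iff.1 (g.injective (Subtype.ext hee)) :)
  · rintro ⟨e, he⟩
    induction e with | _ a b =>
    by_cases h : s(a, b) ∈ E₀
    · change (G (if h : s(a, b) ∈ E₀ then κ ⟨_, h⟩ else g ⟨_, he, h⟩)).Adj _ _
      rw [dif_pos h]
      exact h₀ a b h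
    · change (G (if h : s(a, b) ∈ E₀ then κ ⟨_, h⟩ else g ⟨_, he, h⟩)).Adj _ _
      rw [dif_neg h]
      exact h₁ a b he h _ (Finset.mem_sdiff.1 (g ⟨s(a, b), he, h⟩).2).1

lemma hasRainbowCopy_of_monochromatic [Finite W] {t : ℕ} {G : Fin t → SimpleGraph V}
    {H : SimpleGraph W} (φ : W ↪ V) (I : Finset (Fin t)) (hI : H.edgeSet.ncard ≤ I.card)
    (h : ∀ x y, H.Adj x y → ∀ i ∈ I, (G i).Adj (φ x) (φ y)) : HasRainbowCopy G H :=
  hasRainbowCopy_of_partial φ ∅ (Set.empty_subset _) (fun e => e.2.elim) (fun e => e.2.elim) I hI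
    (fun _ _ h => h.elim) (fun x y hxy _ => h x y hxy)

lemma hasRainbowCopy_congr_induce {t : ℕ} {G : Fin t → SimpleGraph V} {H : SimpleGraph W}
    {S S' : Set W} (h : S = S') : HasRainbowCopy G (H.induce S) ↔ HasRainbowCopy G (H.induce S') := by
  subst h
  rfl

/-! ### The families -/

lemma rainbowFree_deleteIndep {t : ℕ} {G : Fin t → SimpleGraph V} {F : SimpleGraph W} :
    RainbowFree G (deleteIndep F) ↔
      ∀ S : Set W, F.IsIndepSet Sᶜ → ¬ HasRainbowCopy G (F.induce S) := by
  constructor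
  · intro h S hS hc
    refine h ⟨↥(Sᶜᶜ), F.induce Sᶜᶜ⟩ ⟨Sᶜ, hS, rfl⟩ ?_
    exact (hasRainbowCopy_congr_induce (compl_compl S)).2 hc
  · rintro h _ ⟨I, hI, rfl⟩
    exact h Iᶜ (by rwa [compl_compl])

lemma rainbowFree_withMatching {t : ℕ} {G : Fin t → SimpleGraph V} {F : SimpleGraph W} {s : ℕ} :
    RainbowFree G (withMatching F s) ↔
      ¬ HasRainbowCopy G F ∧ ¬ HasRainbowCopy G (matching (s + 1)) := by
  constructor
  · intro h
    exact ⟨h ⟨W, F⟩ (Or.inl rfl), h ⟨Fin (s + 1) × Bool, matching (s + 1)⟩ (Or.inr rfl)⟩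
  · rintro ⟨h1, h2⟩ _ (rfl | rfl)
    exacts [h1, h2]

lemma isVertexCover_iff_isIndepSet_compl {F : SimpleGraph W} {S : Set W} :
    F.IsVertexCover S ↔ F.IsIndepSet Sᶜ := by
  constructor
  · intro h a ha b hb _ hab
    rcases h hab with h | h
    exacts [ha h, hb h]
  · intro h a b hab
    by_contra hc
    rw [not_or] at hc
    exact h hc.1 hc.2 hab.ne hab

/-- Only covers with at most `k` vertices can embed in `Fin k`, so the size restriction is harmless.
If there are none, both conditions are vacuous, since `K_{k+1}` does not fit either. -/
lemma rainbowFree_coverFamily [Finite W] {t k : ℕ} {G : Fin t → SimpleGraph (Fin k)}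
    {F : SimpleGraph W} :
    RainbowFree G (coverFamily F k) ↔ RainbowFree G (deleteIndep F) := by
  have hle : ∀ S : Set W, HasRainbowCopy G (F.induce S) → S.encard ≤ k := by
    rintro S ⟨φ, -⟩
    have := ENat.card_le_card_of_injective φ.injective
    rwa [ENat.card_coe_set_eq, ENat.card_eq_coe_fintype_card, Fintype.card_fin] at this
  rw [rainbowFree_deleteIndep, coverFamily]
  split_ifs with h
  · constructor
    · intro h' S hS hc
      exact h' ⟨↥S, F.induce S⟩
        ⟨S, isVertexCover_iff_isIndepSet_compl.2 hS, hle S hc, rfl⟩ hc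
    · rintro h' _ ⟨S, hS, _, rfl⟩
      exact h' S (isVertexCover_iff_isIndepSet_compl.1 hS)
  · constructor
    · intro _ S hS hc
      exact h ⟨S, isVertexCover_iff_isIndepSet_compl.2 hS, hle S hc⟩
    · rintro _ _ rfl ⟨φ, -⟩
      simpa using Fintype.card_le_of_injective φ φ.injective

lemma isRainbowEx_coverFamily [Finite W] {t k e : ℕ} {F : SimpleGraph W} :
    IsRainbowEx t k (coverFamily F k) e ↔ IsRainbowEx t k (deleteIndep F) e := by
  simp only [IsRainbowEx, rainbowFree_coverFamily]

lemma exists_isRainbowEx {t n : ℕ} {𝓗 : GraphFamily} (ht : 0 < t)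
    (h : ∃ G : Fin t → SimpleGraph (Fin n), RainbowFree G 𝓗) : ∃ e, IsRainbowEx t n 𝓗 e := by
  refine BddAbove.exists_isGreatest_of_nonempty ⟨n ^ 2, ?_⟩ ?_
  · rintro k ⟨G, -, hk⟩
    refine (hk ⟨0, ht⟩).trans ?_
    rw [← edgesIn_univ]
    simpa using card_edgesIn_le_sq (G ⟨0, ht⟩) Finset.univ
  · obtain ⟨G, hG⟩ := h
    exact ⟨0, G, hG, fun _ => Nat.zero_le _⟩

/-- Makes the extremal number on the core exist: a copy in edgeless graphs would need an independent
cover with at most `k` vertices. -/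
lemma rainbowFree_bot_deleteIndep [Finite W] {F : SimpleGraph W} {t k : ℕ}
    (hF : NoIndepCover F k) :
    RainbowFree (fun _ : Fin t => (⊥ : SimpleGraph (Fin k))) (deleteIndep F) := by
  rw [rainbowFree_deleteIndep]
  intro S hS h
  obtain ⟨φ, κ, -, h⟩ := h.exists_coloring
  refine absurd (hF S ?_ hS) ?_
  · intro a ha b hb _ hab
    exact h ⟨a, ha⟩ ⟨b, hb⟩ hab
  · have := Nat.card_le_card_of_injective φ φ.injective
    rw [Nat.card_coe_set_eq] at this
    simpa using this

/-! ### The lower bound -/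

/-- The graph `G₀` completely joined to an independent set. -/
def joinIndep {k m : ℕ} (G₀ : SimpleGraph (Fin k)) : SimpleGraph (Fin k ⊕ Fin m) :=
  G₀.map Function.Embedding.inl ⊔ completeBipartiteGraph (Fin k) (Fin m)

lemma joinIndep_adj_inl {k m : ℕ} {G₀ : SimpleGraph (Fin k)} {a b : Fin k} :
    (joinIndep (m := m) G₀).Adj (.inl a) (.inl b) ↔ G₀.Adj a b := by
  simp [joinIndep, SimpleGraph.map_adj]

lemma not_joinIndep_adj_inr {k m : ℕ} {G₀ : SimpleGraph (Fin k)} {a b : Fin m} :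
    ¬ (joinIndep G₀).Adj (.inr a) (.inr b) := by
  simp [joinIndep, SimpleGraph.map_adj]

lemma le_ncard_edgeSet_joinIndep {k m : ℕ} (G₀ : SimpleGraph (Fin k)) :
    k * m + G₀.edgeSet.ncard ≤ (joinIndep (m := m) G₀).edgeSet.ncard := by
  set f : Fin k × Fin m → Sym2 (Fin k ⊕ Fin m) := fun x => s(.inl x.1, .inr x.2)
  have hf : Function.Injective f := by
    rintro ⟨a, b⟩ ⟨c, d⟩ h
    simpa [f] using h
  set g : Sym2 (Fin k) → Sym2 (Fin k ⊕ Fin m) := Sym2.map Sum.inl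
  have hg : Function.Injective g := Sym2.map.injective Sum.inl_injective
  have hd : Disjoint (f '' Set.univ) (g '' G₀.edgeSet) := by
    rw [Set.disjoint_left]
    rintro _ ⟨⟨a, b⟩, -, rfl⟩ ⟨e, -, he⟩
    induction e with | _ x y => simp [f, g] at he
  calc k * m + G₀.edgeSet.ncard = (f '' Set.univ ∪ g '' G₀.edgeSet).ncard := by
        rw [Set.ncard_union_eq hd, Set.ncard_image_of_injective _ hf,
          Set.ncard_image_of_injective _ hg, Set.ncard_univ]
        simp
    _ ≤ _ := by
        refine Set.ncard_le_ncard ?_ (Set.toFinite _)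
        rintro _ (⟨⟨a, b⟩, -, rfl⟩ | ⟨e, he, rfl⟩)
        · simp [f, joinIndep]
        · induction e with | _ x y => exact joinIndep_adj_inl.2 he

lemma not_hasRainbowCopy_matching_of_covers {t s : ℕ} {G : Fin t → SimpleGraph V}
    {A : Finset V} (hA : A.card ≤ s) (h : ∀ i, Covers (G i) A) :
    ¬ HasRainbowCopy G (matching (s + 1)) := by
  intro hc
  obtain ⟨φ, κ, -, hκ⟩ := hc.exists_coloring
  have hex : ∀ j : Fin (s + 1), ∃ b, φ (j, b) ∈ A := fun j =>
    (h _ _ _ (hκ (j, false) (j, true) ⟨rfl, by simp⟩)).elim (fun h => ⟨_, h⟩) (fun h => ⟨_, h⟩)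
  choose b hb using hex
  have := Finset.card_le_card_of_injOn (s := Finset.univ) (fun j => φ (j, b j))
    (fun j _ => hb j) (fun i _ j _ hij => congrArg Prod.fst (φ.injective hij))
  simp at this
  omega

/-- The part of a copy of `F` outside the core is independent in `F`, so its part inside the core
would be a forbidden graph. -/
lemma exists_collection_of_deleteIndep {F : SimpleGraph W} {s t k n e : ℕ} (hks : k ≤ s)
    (hkn : k ≤ n) (G₀ : Fin t → SimpleGraph (Fin k)) (hG₀ : RainbowFree G₀ (deleteIndep F))
    (he : ∀ i, e ≤ (G₀ i).edgeSet.ncard) :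
    ∃ G : Fin t → SimpleGraph (Fin n), RainbowFree G (withMatching F s) ∧
      ∀ i, k * (n - k) + e ≤ (G i).edgeSet.ncard := by
  obtain ⟨m, rfl⟩ := Nat.exists_eq_add_of_le hkn
  refine ⟨fun i => (joinIndep (G₀ i)).comap finSumFinEquiv.symm, ?_, ?_⟩
  · suffices h : RainbowFree (fun i => joinIndep (m := m) (G₀ i)) (withMatching F s) by
      intro H hH hc
      exact h H hH (hc.map finSumFinEquiv.symm.toEmbedding fun i a b hab => hab)
    rw [rainbowFree_withMatching]
    constructor
    · intro hc
      obtain ⟨φ, κ, hκ, h⟩ := hc.exists_coloring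
      refine rainbowFree_deleteIndep.1 hG₀ {w | (φ w).isLeft} ?_ ?_
      · intro a ha b hb _ hab
        have := h a b hab
        simp only [Set.mem_compl_iff, Set.mem_ofPred_eq, Bool.not_eq_true, Sum.isLeft_eq_false,
          Sum.isRight_iff] at ha hb
        obtain ⟨x, hx⟩ := ha
        obtain ⟨y, hy⟩ := hb
        rw [hx, hy] at this
        exact not_joinIndep_adj_inr this
      · set S : Set W := {w | (φ w).isLeft}
        have hex : ∀ w : S, ∃ x, φ w = Sum.inl x := fun w => Sum.isLeft_iff.1 w.2
        choose ψ hψ using hex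
        have hmap : ∀ e : (F.induce S).edgeSet, e.1.map Subtype.val ∈ F.edgeSet := by
          rintro ⟨e, he⟩
          induction e with | _ a b => exact he
        refine ⟨⟨ψ, fun w w' hw => Subtype.ext (φ.injective ?_)⟩,
          ⟨fun e => κ ⟨e.1.map Subtype.val, hmap e⟩, fun e e' hee => ?_⟩, ?_⟩
        · rw [hψ, hψ, hw]
        · have := Subtype.ext_iff.1 (hκ hee)
          exact Subtype.ext (Sym2.map.injective Subtype.val_injective this)
        · rintro ⟨e, he⟩
          induction e with | _ a b =>
          have hab := h a b (hmap ⟨s(a, b), he⟩)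
          rw [hψ, hψ] at hab
          exact joinIndep_adj_inl.1 hab
    · refine not_hasRainbowCopy_matching_of_covers (A := Finset.univ.map Function.Embedding.inl)
        (by simpa using hks) ?_
      rintro i (a | a) (b | b) hab
      · simp
      · simp
      · simp
      · exact absurd hab not_joinIndep_adj_inr
  · intro i
    have h1 := le_ncard_edgeSet_joinIndep (m := m) (G₀ i)
    have h2 : ((joinIndep (m := m) (G₀ i)).comap finSumFinEquiv.symm).edgeSet.ncard =
        (joinIndep (m := m) (G₀ i)).edgeSet.ncard := by
      have := card_edgesIn_range (joinIndep (m := m) (G₀ i)) finSumFinEquiv.symm.toEmbedding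
      rw [Finset.map_univ_equiv, edgesIn_univ] at this
      exact this.symm
    simp only [Nat.add_sub_cancel_left]
    rw [h2]
    have := he i
    omega

/-! ### Rainbow matchings -/

/-- The two coordinates of a pair, as a finset. -/
noncomputable def ends (x : V × V) : Finset V := {x.1, x.2}

lemma card_ends_le (x : V × V) : (ends x).card ≤ 2 := Finset.card_le_two

/-- The edges `f i`, for `i ∈ J`, are pairwise disjoint and `f i` is an edge of `G i`. -/
def IsRainbowMatching {t : ℕ} (G : Fin t → SimpleGraph V) (J : Finset (Fin t))
    (f : Fin t → V × V) : Prop :=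
  (∀ i ∈ J, (G i).Adj (f i).1 (f i).2) ∧
    ∀ i ∈ J, ∀ j ∈ J, i ≠ j → Disjoint (ends (f i)) (ends (f j))

lemma IsRainbowMatching.hasRainbowCopy {t s : ℕ} {G : Fin t → SimpleGraph V}
    {J : Finset (Fin t)} {f : Fin t → V × V} (h : IsRainbowMatching G J f)
    (hJ : J.card = s) : HasRainbowCopy G (matching s) := by
  let σ : Fin s ≃ J := (J.equivFinOfCardEq hJ).symm
  let φ : Fin s × Bool → V := fun x => if x.2 then (f (σ x.1)).2 else (f (σ x.1)).1
  have hmem : ∀ x, φ x ∈ ends (f (σ x.1)) := by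
    rintro ⟨j, b⟩
    cases b <;> simp [φ, ends]
  have hφ : Function.Injective φ := by
    rintro ⟨j, b⟩ ⟨j', b'⟩ hx
    have hj : j = j' := by
      by_contra hne
      have hd := h.2 (σ j) (σ j).2 (σ j') (σ j').2
        (fun h => hne (σ.injective (Subtype.ext h)))
      exact Finset.disjoint_left.1 hd (hmem (j, b)) (hx ▸ hmem (j', b'))
    subst hj
    have hne := (h.1 (σ j) (σ j).2).ne
    cases b <;> cases b' <;> simp [φ, hne, hne.symm] at hx ⊢
  -- The colour of an edge is read off a chosen representative; both ends carry the same index, so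
  -- the choice is immaterial.
  have hout : ∀ x y, (matching s).Adj x y → (s(x, y).out).1.1 = x.1 := by
    intro x y hxy
    have h1 : s(s(x, y).out.1, s(x, y).out.2) = s(x, y) := Quot.out_eq _
    rw [Sym2.eq_iff] at h1
    rcases h1 with h1 | h1
    · rw [h1.1]
    · rw [h1.1, hxy.1]
  refine hasRainbowCopy_of_coloring ⟨φ, hφ⟩ (fun e => σ e.out.1.1) ?_ ?_
  · intro e he e' he' hee
    induction e with | _ x y =>
    induction e' with | _ x' y' =>
    simp only at hee
    rw [hout x y he, hout x' y' he'] at hee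
    have hxx : x.1 = x'.1 := σ.injective (Subtype.ext hee)
    obtain ⟨hxy, hxy'⟩ := he
    obtain ⟨hx, hx'⟩ := he'
    obtain ⟨a, b⟩ := x
    obtain ⟨a', b'⟩ := y
    obtain ⟨c, d⟩ := x'
    obtain ⟨c', d'⟩ := y'
    simp only at hxx hxy hxy' hx hx'
    subst hxx hxy hx
    rw [Sym2.eq_iff]
    cases b <;> cases b' <;> cases d <;> cases d' <;>
      first
        | exact absurd rfl hxy'
        | exact absurd rfl hx'
        | exact Or.inl ⟨rfl, rfl⟩
        | exact Or.inr ⟨rfl, rfl⟩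
  · intro x y hxy
    rw [hout x y hxy]
    have h1 := h.1 (σ x.1) (σ x.1).2
    obtain ⟨a, b⟩ := x
    obtain ⟨a', b'⟩ := y
    obtain ⟨rfl, hb⟩ := hxy
    cases b <;> cases b' <;>
      first
        | exact absurd rfl hb
        | exact h1
        | exact h1.symm

/-- Edges can be chosen greedily for colours whose edges avoid given disjoint small sets. -/
lemma exists_isRainbowMatching {t : ℕ} {G : Fin t → SimpleGraph V} (J : Finset (Fin t))
    (hJ₀ : J.Nonempty) (T : Fin t → Finset V) (hT : ∀ i ∈ J, (T i).card ≤ 2)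
    (hd : ∀ i ∈ J, ∀ j ∈ J, i ≠ j → Disjoint (T i) (T j))
    (h : ∀ i ∈ J, ∀ X : Finset V, X.card ≤ 2 * J.card → Disjoint X (T i) →
      ∃ a b, (G i).Adj a b ∧ a ∉ X ∧ b ∉ X) :
    ∃ f, IsRainbowMatching G J f := by
  obtain ⟨i₀, hi₀⟩ := hJ₀
  obtain ⟨v₀, -⟩ := h i₀ hi₀ ∅ (by simp) (by simp)
  -- Induction on the colours already served; the second clause keeps the sets reserved for pending
  -- colours untouched.
  suffices H : ∀ J' ⊆ J, ∃ f, IsRainbowMatching G J' f ∧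
      ∀ i ∈ J', ∀ j ∈ J \ J', Disjoint (ends (f i)) (T j) by
    obtain ⟨f, hf, -⟩ := H J subset_rfl
    exact ⟨f, hf⟩
  intro J'
  induction J' using Finset.induction with
  | empty => exact fun _ => ⟨fun _ => (v₀, v₀), ⟨by simp, by simp⟩, by simp⟩
  | insert i J' hi ih =>
    intro hJ
    obtain ⟨f, hf, hfT⟩ := ih ((Finset.subset_insert _ _).trans hJ)
    have hiJ : i ∈ J := hJ (Finset.mem_insert_self _ _)
    set X : Finset V := J'.biUnion (fun j => ends (f j)) ∪ (J \ insert i J').biUnion T with hX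
    obtain ⟨a, b, hab, ha, hb⟩ := h i hiJ X (by
      calc X.card ≤ J'.card * 2 + (J \ insert i J').card * 2 := by
            refine (Finset.card_union_le _ _).trans (add_le_add ?_ ?_)
            · exact Finset.card_biUnion_le_card_mul _ _ _ fun j _ => card_ends_le _
            · exact Finset.card_biUnion_le_card_mul _ _ _
                fun j hj => hT j (Finset.mem_sdiff.1 hj).1
        _ ≤ 2 * J.card := by
            have h1 := Finset.card_sdiff_add_card_eq_card hJ
            rw [Finset.card_insert_of_notMem hi] at h1
            omega) (by
      rw [hX, Finset.disjoint_union_left, Finset.disjoint_biUnion_left,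
        Finset.disjoint_biUnion_left]
      constructor
      · exact fun j hj => hfT j hj i (Finset.mem_sdiff.2 ⟨hiJ, hi⟩)
      · intro j hj
        rw [Finset.mem_sdiff, Finset.mem_insert, not_or] at hj
        exact hd j hj.1 i hiJ hj.2.1)
    have hne : ∀ j ∈ J', j ≠ i := fun j hj h => hi (h ▸ hj)
    have hab' : Disjoint (ends (a, b)) X := by
      rw [Finset.disjoint_left]
      intro x hx
      simp only [ends, Finset.mem_insert, Finset.mem_singleton] at hx
      rcases hx with rfl | rfl
      exacts [ha, hb]
    rw [hX, Finset.disjoint_union_right, Finset.disjoint_biUnion_right,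
      Finset.disjoint_biUnion_right] at hab'
    refine ⟨Function.update f i (a, b), ⟨?_, ?_⟩, ?_⟩
    · intro j hj
      rcases Finset.mem_insert.1 hj with rfl | hj
      · simpa using hab
      · simpa [hne j hj] using hf.1 j hj
    · intro j hj k hk hjk
      rcases Finset.mem_insert.1 hj with rfl | hj' <;>
        rcases Finset.mem_insert.1 hk with rfl | hk'
      · exact absurd rfl hjk
      · simpa [hne k hk'] using hab'.1 k hk'
      · simpa [hne j hj'] using (hab'.1 j hj').symm
      · simpa [hne j hj', hne k hk'] using hf.2 j hj' k hk' hjk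
    · intro j hj k hk
      rcases Finset.mem_insert.1 hj with rfl | hj
      · simpa using hab'.2 k hk
      · rw [Function.update_of_ne (hne j hj)]
        refine hfT j hj k ?_
        rw [Finset.mem_sdiff, Finset.mem_insert, not_or] at hk
        exact Finset.mem_sdiff.2 ⟨hk.1, hk.2.2⟩

/-- A system of distinct representatives, as singletons. -/
lemma exists_singletons_of_hall {ι : Type} (J : Finset ι) (A : ι → Finset V)
    (h : ∀ S ⊆ J, S.Nonempty → S.card ≤ (S.biUnion A).card) :
    ∃ T : ι → Finset V, (∀ i ∈ J, ∃ v ∈ A i, T i = {v}) ∧ (∀ i ∉ J, T i = ∅) ∧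
      ∀ i ∈ J, ∀ j ∈ J, i ≠ j → Disjoint (T i) (T j) := by
  obtain ⟨v, hv, hvA⟩ := (Finset.all_card_le_biUnion_card_iff_exists_injective
    (fun i : J => A i)).1 (by
      intro S
      rcases S.eq_empty_or_nonempty with rfl | hS
      · simp
      have := h (S.map (Function.Embedding.subtype _)) (by
        intro x hx
        obtain ⟨y, -, rfl⟩ := Finset.mem_map.1 hx
        exact y.2) (by simpa using hS)
      rw [Finset.card_map] at this
      refine this.trans (Finset.card_le_card ?_)
      intro x hx
      simp only [Finset.mem_biUnion, Finset.mem_map] at hx ⊢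
      obtain ⟨_, ⟨y, hy, rfl⟩, hx⟩ := hx
      exact ⟨y, hy, hx⟩)
  refine ⟨fun i => if h : i ∈ J then {v ⟨i, h⟩} else ∅, ?_, ?_, ?_⟩
  · intro i hi
    exact ⟨v ⟨i, hi⟩, hvA ⟨i, hi⟩, by simp [hi]⟩
  · intro i hi
    simp [hi]
  · intro i hi j hj hij
    simp only [hi, hj, dif_pos, Finset.disjoint_singleton]
    exact fun h => hij (congrArg Subtype.val (hv h))

/-- Without a large rainbow matching, almost all graphs have a small common cover. -/
lemma exists_cover_of_no_matching {t s : ℕ} {G : Fin t → SimpleGraph V}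
    (hM : ¬ HasRainbowCopy G (matching (s + 1))) :
    ∃ (J : Finset (Fin t)) (Z : Finset V), J.card ≤ s ∧ Z.card ≤ 2 * s ∧
      ∀ i ∉ J, Covers (G i) Z := by
  by_contra! hcon
  have H : ∀ r ≤ s + 1, ∃ J f, J.card = r ∧ IsRainbowMatching G J f := by
    intro r
    induction r with
    | zero =>
      intro _
      -- Needed only for a vertex of `V` to serve as default value of `f`.
      obtain ⟨i, -, hi⟩ := hcon ∅ ∅ (by simp) (by simp)
      simp only [Covers, not_forall] at hi
      obtain ⟨a, -⟩ := hi
      exact ⟨∅, fun _ => (a, a), rfl, by simp, by simp⟩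
    | succ r ih =>
      intro hr
      obtain ⟨J, f, hJ, hf⟩ := ih (by omega)
      -- If the ends of the current matching do not cover some unused colour, an uncovered edge
      -- extends the matching.
      obtain ⟨i, hi, hcov⟩ := hcon J (J.biUnion fun j => ends (f j)) (by omega) (by
        refine (Finset.card_biUnion_le_card_mul _ _ _ fun j _ => card_ends_le _).trans ?_
        omega)
      simp only [Covers, not_forall, not_or] at hcov
      obtain ⟨a, b, hab, ha, hb⟩ := hcov
      have hne : ∀ j ∈ J, j ≠ i := fun j hj h => hi (h ▸ hj)
      have hab' : ∀ j ∈ J, Disjoint (ends (a, b)) (ends (f j)) := by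
        rw [← Finset.disjoint_biUnion_right, Finset.disjoint_left]
        intro x hx
        simp only [ends, Finset.mem_insert, Finset.mem_singleton] at hx
        rcases hx with rfl | rfl
        exacts [ha, hb]
      refine ⟨insert i J, Function.update f i (a, b), by rw [Finset.card_insert_of_notMem hi, hJ],
        ?_, ?_⟩
      · intro j hj
        rcases Finset.mem_insert.1 hj with rfl | hj
        · simpa using hab
        · simpa [hne j hj] using hf.1 j hj
      · intro j hj k hk hjk
        rcases Finset.mem_insert.1 hj with rfl | hj' <;>
        rcases Finset.mem_insert.1 hk with rfl | hk'
        · exact absurd rfl hjk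
        · simpa [hne k hk'] using hab' k hk'
        · simpa [hne j hj'] using (hab' j hj').symm
        · simpa [hne j hj', hne k hk'] using hf.2 j hj' k hk' hjk
  obtain ⟨J, f, hJ, hf⟩ := H (s + 1) le_rfl
  exact hM (hf.hasRainbowCopy hJ)

/-! ### The structure of dense collections without a rainbow matching -/

/-- If `X` met every edge, summing degrees over `X` would give at most `(s - 1) * |V| + m * m`
edges, as fewer than `s` vertices have degree above `m`. The density hypothesis is stated without
subtraction. -/
lemma exists_adj_notMem_of_few_large_degrees [Fintype V] {G : SimpleGraph V} {A : Finset V}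
    {s m : ℕ} (hA : ∀ v ∉ A, (nbrsIn G Finset.univ v).card ≤ m) (hAs : A.card < s)
    (hG : s * Fintype.card V + m * m < G.edgeSet.ncard + Fintype.card V) {X : Finset V}
    (hX : X.card ≤ m) : ∃ a b, G.Adj a b ∧ a ∉ X ∧ b ∉ X := by
  by_contra! hcon
  have hcov : Covers G X := fun a b hab => by
    by_contra! h
    exact h.2 (hcon a b hab h.1)
  have h1 := ncard_edgeSet_le_sum_degree hcov
  have h2 : ∀ u ∈ X, (nbrsIn G Finset.univ u).card ≤
      (if u ∈ A then Fintype.card V else 0) + m := by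
    intro u _
    by_cases hu : u ∈ A
    · rw [if_pos hu]
      exact (Finset.card_le_univ _).trans (Nat.le_add_right _ _)
    · rw [if_neg hu, zero_add]
      exact hA u hu
  have h3 := h1.trans (Finset.sum_le_sum h2)
  rw [Finset.sum_add_distrib, ← Finset.sum_filter, Finset.sum_const, Finset.sum_const,
    smul_eq_mul, smul_eq_mul] at h3
  have h4 : (X.filter (· ∈ A)).card ≤ A.card :=
    Finset.card_le_card fun x hx => (Finset.mem_filter.1 hx).2
  have h5 : (X.filter (· ∈ A)).card * Fintype.card V + Fintype.card V ≤ s * Fintype.card V := by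
    rw [← Nat.succ_mul]
    exact Nat.mul_le_mul_right _ (by omega)
  have h6 : X.card * m ≤ m * m := Nat.mul_le_mul_right _ hX
  omega

lemma exists_adj_notMem_of_large_degree [Fintype V] {G : SimpleGraph V} {v : V} {X : Finset V}
    (h : X.card < (nbrsIn G Finset.univ v).card) (hv : v ∉ X) :
    ∃ a b, G.Adj a b ∧ a ∉ X ∧ b ∉ X := by
  obtain ⟨b, hb, hbX⟩ := Finset.exists_mem_notMem_of_card_lt_card h
  exact ⟨v, b, (mem_nbrsIn.1 hb).2, hv, hbX⟩

/-- A collection of at least `s + 1` dense graphs without a rainbow matching of size `s + 1` has a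
common cover of size `s`. -/
lemma exists_common_cover [Fintype V] {t s : ℕ} {G : Fin t → SimpleGraph V}
    (hM : ¬ HasRainbowCopy G (matching (s + 1))) (ht : s + 1 ≤ t)
    (hG : ∀ i, s * Fintype.card V + (2 * (s + 1)) * (2 * (s + 1)) <
      (G i).edgeSet.ncard + Fintype.card V) :
    ∃ A : Finset V, A.card = s ∧ ∀ i, Covers (G i) A := by
  set m := 2 * (s + 1) with hm
  -- A vertex of degree above `m` keeps an edge that avoids any `m` other vertices, so reserving the
  -- vertex suffices for a greedy choice.
  set A : Fin t → Finset V := fun i =>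
    Finset.univ.filter fun v => m < (nbrsIn (G i) Finset.univ v).card with hAdef
  have hmemA : ∀ {i v}, v ∈ A i ↔ m < (nbrsIn (G i) Finset.univ v).card := by
    intro i v
    simp [hAdef]
  have hnot : ∀ (J : Finset (Fin t)) (T : Fin t → Finset V), J.card = s + 1 →
      (∀ i ∈ J, (T i).card ≤ 2) → (∀ i ∈ J, ∀ j ∈ J, i ≠ j → Disjoint (T i) (T j)) →
      ¬ ∀ i ∈ J, ∀ X : Finset V, X.card ≤ m → Disjoint X (T i) →
        ∃ a b, (G i).Adj a b ∧ a ∉ X ∧ b ∉ X := by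
    intro J T hJ hT hd h
    obtain ⟨f, hf⟩ := exists_isRainbowMatching J (Finset.card_pos.1 (by omega)) T hT hd
      (by rwa [hJ])
    exact hM (hf.hasRainbowCopy hJ)
  have hsingle : ∀ i, ∀ T : Finset V, (∃ v ∈ A i, T = {v}) → ∀ X : Finset V, X.card ≤ m →
      Disjoint X T → ∃ a b, (G i).Adj a b ∧ a ∉ X ∧ b ∉ X := by
    rintro i _ ⟨v, hv, rfl⟩ X hX hd
    exact exists_adj_notMem_of_large_degree (hX.trans_lt (hmemA.1 hv)) (by simpa using hd)
  have hsuper : ∀ J₀ : Finset (Fin t), J₀.card ≤ s + 1 → ∃ J, J₀ ⊆ J ∧ J.card = s + 1 := by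
    intro J₀ h
    exact Finset.exists_superset_card_eq h (by simpa using ht)
  -- If `A i₀` is small, at most `s` colours of `J` have `s` or more large vertices, so Hall gives
  -- them distinct ones. The remaining colours need no reservation: their edges cannot all meet a
  -- small set.
  have hlarge : ∀ i, s ≤ (A i).card := by
    intro i₀
    by_contra! hi₀
    obtain ⟨J, hJ₀, hJ⟩ := hsuper {i₀} (by simp)
    rw [Finset.singleton_subset_iff] at hJ₀
    have hcard : (J.filter fun i => s ≤ (A i).card).card ≤ s := by
      have : J.filter (fun i => s ≤ (A i).card) ⊆ J.erase i₀ := by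
        intro i hi
        rw [Finset.mem_filter] at hi
        exact Finset.mem_erase.2 ⟨fun h => by subst h; omega, hi.1⟩
      have := Finset.card_le_card this
      rw [Finset.card_erase_of_mem hJ₀] at this
      omega
    obtain ⟨T, hT, hT', hd⟩ := exists_singletons_of_hall (J.filter fun i => s ≤ (A i).card) A (by
      rintro S hS ⟨i, hi⟩
      calc S.card ≤ _ := Finset.card_le_card hS
        _ ≤ s := hcard
        _ ≤ (A i).card := (Finset.mem_filter.1 (hS hi)).2
        _ ≤ _ := Finset.card_le_card (Finset.subset_biUnion_of_mem A hi))
    refine hnot J T hJ ?_ ?_ ?_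
    · intro i _
      by_cases hi : i ∈ J.filter fun i => s ≤ (A i).card
      · obtain ⟨v, -, hv⟩ := hT i hi
        simp [hv]
      · simp [hT' i hi]
    · intro i _ j _ hij
      by_cases hi : i ∈ J.filter fun i => s ≤ (A i).card
      · by_cases hj : j ∈ J.filter fun i => s ≤ (A i).card
        · exact hd i hi j hj hij
        · simp [hT' j hj]
      · simp [hT' i hi]
    · intro i hi X hX hXT
      by_cases hi' : i ∈ J.filter fun i => s ≤ (A i).card
      · exact hsingle i _ (hT i hi') X hX hXT
      · refine exists_adj_notMem_of_few_large_degrees (A := A i) (m := m) ?_ ?_ (hG i) hX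
        · intro v hv
          rwa [hmemA, not_lt] at hv
        · by_contra! h
          exact hi' (Finset.mem_filter.2 ⟨hi, h⟩)
  -- With `s + 1` vertices in the union, Hall's condition holds for all of `J`: proper subsets are
  -- served by a single `A i`.
  have hunion : ∀ J : Finset (Fin t), J.card = s + 1 → (J.biUnion A).card ≤ s := by
    intro J hJ
    by_contra! hcon
    obtain ⟨T, hT, -, hd⟩ := exists_singletons_of_hall J A (by
      rintro S hS ⟨i, hi⟩
      rcases hS.eq_or_ssubset with rfl | hS
      · omega
      · have h1 := Finset.card_lt_card hS
        have h2 := hlarge i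
        have h3 := Finset.card_le_card (Finset.subset_biUnion_of_mem A hi)
        omega)
    refine hnot J T hJ ?_ hd fun i hi => hsingle i _ (hT i hi)
    intro i hi
    obtain ⟨v, -, hv⟩ := hT i hi
    simp [hv]
  have heqU : ∀ J : Finset (Fin t), J.card = s + 1 → ∀ i ∈ J, A i = J.biUnion A :=
    fun J hJ i hi => Finset.eq_of_subset_of_card_le (Finset.subset_biUnion_of_mem A hi)
      ((hunion J hJ).trans (hlarge i))
  have hcardA : ∀ i, (A i).card = s := by
    intro i
    obtain ⟨J, hJ₀, hJ⟩ := hsuper {i} (by simp)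
    rw [Finset.singleton_subset_iff] at hJ₀
    exact le_antisymm (heqU J hJ i hJ₀ ▸ hunion J hJ) (hlarge i)
  have hall : ∀ i j, A i = A j := by
    intro i j
    -- For `s = 0` two colours need not fit into a set of `s + 1` colours, but then all `A i` are
    -- empty.
    rcases s.eq_zero_or_pos with hs | hs
    · rw [Finset.card_eq_zero.1 ((hcardA i).trans hs), Finset.card_eq_zero.1 ((hcardA j).trans hs)]
    · obtain ⟨J, hJ₀, hJ⟩ := hsuper {i, j} (Finset.card_le_two.trans (by omega))
      rw [heqU J hJ i (hJ₀ (by simp)), heqU J hJ j (hJ₀ (by simp))]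
  refine ⟨A ⟨0, by omega⟩, hcardA _, ?_⟩
  intro i a b hab
  by_contra! hout
  obtain ⟨J, hJ₀, hJ⟩ := hsuper {i} (by simp)
  rw [Finset.singleton_subset_iff] at hJ₀
  -- An edge of `G i` missing the common set, together with distinct large vertices for the `s`
  -- other colours, would give a rainbow matching.
  obtain ⟨T, hT, -, hd⟩ := exists_singletons_of_hall (J.erase i) A (by
    rintro S hS ⟨j, hj⟩
    have h1 := Finset.card_le_card hS
    rw [Finset.card_erase_of_mem hJ₀] at h1
    have h2 := hlarge j
    have h3 := Finset.card_le_card (Finset.subset_biUnion_of_mem A hj)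
    omega)
  have hab' : ∀ j ∈ J, j ≠ i → Disjoint (ends (a, b)) (T j) := by
    intro j hj hji
    obtain ⟨v, hv, hv'⟩ := hT j (Finset.mem_erase.2 ⟨hji, hj⟩)
    rw [hall j ⟨0, by omega⟩] at hv
    rw [hv', Finset.disjoint_singleton_right]
    intro h
    simp only [ends, Finset.mem_insert, Finset.mem_singleton] at h
    rcases h with rfl | rfl
    exacts [hout.1 hv, hout.2 hv]
  refine hnot J (Function.update T i (ends (a, b))) hJ ?_ ?_ ?_
  · intro j hj
    rcases eq_or_ne j i with rfl | hji
    · simpa using card_ends_le (a, b)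
    · obtain ⟨v, -, hv⟩ := hT j (Finset.mem_erase.2 ⟨hji, hj⟩)
      simp [hji, hv]
  · intro j hj k hk hjk
    rcases eq_or_ne j i with rfl | hji
    · simpa [hjk.symm] using hab' k hk hjk.symm
    · rcases eq_or_ne k i with rfl | hki
      · simpa [hji] using (hab' j hj hji).symm
      · simpa [hji, hki] using hd j (Finset.mem_erase.2 ⟨hji, hj⟩) k
          (Finset.mem_erase.2 ⟨hki, hk⟩) hjk
  · intro j hj X hX hXT
    rcases eq_or_ne j i with rfl | hji
    · rw [Function.update_self, Finset.disjoint_right] at hXT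
      exact ⟨a, b, hab, hXT (by simp [ends]), hXT (by simp [ends])⟩
    · rw [Function.update_of_ne hji] at hXT
      exact hsingle j _ (hT j (Finset.mem_erase.2 ⟨hji, hj⟩)) X hX hXT

/-! ### Extending a copy from the cover, and the upper bound for (i) and (ii) -/

/-- A rainbow copy of `F` minus an independent set extends to a rainbow copy of `F` when there are
enough vertices completely joined to it in many colours. -/
lemma HasRainbowCopy.extend [Finite W] {t : ℕ} {X : Type} {G : Fin t → SimpleGraph V}
    {F : SimpleGraph W} {S : Set W} (hS : F.IsIndepSet Sᶜ) (f : X ↪ V)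
    (h : HasRainbowCopy (fun i => (G i).comap f) (F.induce S)) (U : Finset V)
    (hU : Nat.card W ≤ U.card) (hUf : ∀ x, f x ∉ U) (I : Finset (Fin t))
    (hI : F.edgeSet.ncard ≤ I.card) (hUI : ∀ u ∈ U, ∀ x, ∀ i ∈ I, (G i).Adj u (f x)) :
    HasRainbowCopy G F := by
  have := Fintype.ofFinite W
  obtain ⟨φ₀, κ, hκ, h⟩ := h.exists_coloring
  obtain ⟨g⟩ : Nonempty (W ↪ U) := Function.Embedding.nonempty_of_card_le (by
    rwa [Fintype.card_coe, ← Nat.card_eq_fintype_card])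
  let φ : W → V := fun w => if h : w ∈ S then f (φ₀ ⟨w, h⟩) else g w
  have hφS : ∀ w (h : w ∈ S), φ w = f (φ₀ ⟨w, h⟩) := fun w h => dif_pos h
  have hφU : ∀ w, w ∉ S → φ w = g w := fun w h => dif_neg h
  have hφ : Function.Injective φ := by
    intro w w' hw
    by_cases h : w ∈ S <;> by_cases h' : w' ∈ S
    · rw [hφS w h, hφS w' h'] at hw
      exact congrArg Subtype.val (φ₀.injective (f.injective hw))
    · rw [hφS w h, hφU w' h'] at hw
      exact absurd (hw ▸ (g w').2) (hUf _)
    · rw [hφU w h, hφS w' h'] at hw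
      exact absurd (hw ▸ (g w).2) (hUf _)
    · rw [hφU w h, hφU w' h'] at hw
      exact g.injective (Subtype.ext hw)
  let ε : (F.induce S).edgeSet → Sym2 W := fun e => e.1.map Subtype.val
  have hε : Function.Injective ε := fun e e' h =>
    Subtype.ext (Sym2.map.injective Subtype.val_injective h)
  -- The edges inside `S` keep their colours. As `Sᶜ` is independent, every other edge joins `S` to
  -- `Sᶜ` and admits all colours of `I`.
  refine hasRainbowCopy_of_partial ⟨φ, hφ⟩ (Set.range ε) ?_
    (fun e => κ ((Equiv.ofInjective ε hε).symm e))
    (hκ.comp (Equiv.injective _)) I hI ?_ ?_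
  · rintro _ ⟨⟨e, he⟩, rfl⟩
    induction e with | _ a b => exact he
  · intro x y hmem
    obtain ⟨⟨e, he⟩, hxy⟩ := id hmem
    have hkey : ∀ (p : Sym2 W) (hp : p ∈ Set.range ε), ε ⟨e, he⟩ = p →
        (Equiv.ofInjective ε hε).symm ⟨p, hp⟩ = ⟨e, he⟩ := by
      rintro _ _ rfl
      exact Equiv.ofInjective_symm_apply hε _
    change (G (κ ((Equiv.ofInjective ε hε).symm ⟨s(x, y), hmem⟩))).Adj (φ x) (φ y)
    rw [hkey _ hmem hxy]
    induction e with | _ a b =>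
    have hab := h a b he
    have hxy' : s(a.1, b.1) = s(x, y) := hxy
    have hmain : (G (κ ⟨s(a, b), he⟩)).Adj (φ a) (φ b) := by
      rw [hφS a a.2, hφS b b.2]
      exact hab
    rw [Sym2.eq_iff] at hxy'
    rcases hxy' with ⟨rfl, rfl⟩ | ⟨rfl, rfl⟩
    exacts [hmain, hmain.symm]
  · intro x y hxy hE i hi
    change (G i).Adj (φ x) (φ y)
    by_cases hx : x ∈ S <;> by_cases hy : y ∈ S
    · exact absurd ⟨⟨s(⟨x, hx⟩, ⟨y, hy⟩), hxy⟩, rfl⟩ hE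
    · rw [hφS x hx, hφU y hy]
      exact (hUI _ (g y).2 _ i hi).symm
    · rw [hφU x hx, hφS y hy]
      exact hUI _ (g x).2 _ i hi
    · exact absurd hxy (hS hx hy hxy.ne)

/-- An embedding enumerating a finset. -/
lemma exists_embedding_map_eq {A : Finset V} {s : ℕ} (hA : A.card = s) :
    ∃ f : Fin s ↪ V, Finset.univ.map f = A := by
  refine ⟨(A.equivFinOfCardEq hA).symm.toEmbedding.trans (Function.Embedding.subtype _), ?_⟩
  ext v
  simp only [Finset.mem_map, Finset.mem_univ, true_and]
  constructor
  · rintro ⟨j, rfl⟩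
    exact ((A.equivFinOfCardEq hA).symm j).2
  · intro hv
    exact ⟨A.equivFinOfCardEq hA ⟨v, hv⟩, by simp⟩

lemma exists_ncard_edgeSet_le [Finite W] {F : SimpleGraph W} {s t e : ℕ}
    (ht : max F.edgeSet.ncard (s + 1) ≤ t) (he : IsRainbowEx t s (deleteIndep F) e) :
    ∃ N : ℕ, ∀ (V : Type) [Fintype V], N ≤ Fintype.card V → ∀ G : Fin t → SimpleGraph V,
      RainbowFree G (withMatching F s) →
        ∃ i, (G i).edgeSet.ncard ≤ s * (Fintype.card V - s) + e := by
  -- The squares give the density required by `exists_common_cover`; `t * (s * s)` bounds the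
  -- outside vertices missing a neighbour in `A` in some colour, and `Nat.card W` of the others must
  -- remain.
  refine ⟨s + s * s + (2 * (s + 1)) * (2 * (s + 1)) + t * (s * s) + Nat.card W + 1, ?_⟩
  intro V _ hn G hfree
  by_contra! hcon
  set n := Fintype.card V with hnV
  rw [rainbowFree_withMatching] at hfree
  obtain ⟨hF, hM⟩ := hfree
  have hsn : s ≤ n := by omega
  have hmul : s * (n - s) + s * s = s * n := by rw [← mul_add, Nat.sub_add_cancel hsn]
  obtain ⟨A, hA, hcov⟩ := exists_common_cover hM (le_of_max_le_right ht) (by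
    intro i
    have := hcon i
    rw [← hnV]
    omega)
  have hAc : Aᶜ.card = n - s := by rw [Finset.card_compl, hA]
  obtain ⟨f, hf⟩ := exists_embedding_map_eq hA
  have hle : ∀ i, ∀ u, (nbrsIn (G i) A u).card ≤ s := fun i u =>
    hA ▸ Finset.card_le_card (Finset.filter_subset _ _)
  have hin : ∀ i, e + 1 ≤ ((G i).comap f).edgeSet.ncard := by
    intro i
    rw [← card_edgesIn_range, hf]
    have h1 := ncard_edgeSet_le_of_covers (hcov i)
    have h2 := Finset.sum_le_card_nsmul Aᶜ (fun u => (nbrsIn (G i) A u).card) s fun u _ => hle i u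
    rw [hAc, smul_eq_mul, mul_comm] at h2
    have := hcon i
    omega
  have hnotfree : ¬ RainbowFree (fun i => (G i).comap f) (deleteIndep F) := by
    intro h
    have := he.2 ⟨_, h, hin⟩
    omega
  rw [rainbowFree_deleteIndep] at hnotfree
  push Not at hnotfree
  obtain ⟨S, hS, hcopy⟩ := hnotfree
  set bad : Fin t → Finset V := fun i =>
    Aᶜ.filter fun u => (nbrsIn (G i) A u).card < s with hbad
  -- Each bad vertex costs an edge against `s * (n - s)`, and the at most `s * s` edges inside `A`
  -- must make up for it.
  have hbadcard : ∀ i, (bad i).card ≤ s * s := by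
    intro i
    have h1 := ncard_edgeSet_le_of_covers (hcov i)
    have h2 : ∑ u ∈ Aᶜ, (nbrsIn (G i) A u).card + (bad i).card ≤ s * (n - s) := by
      rw [hbad, Finset.card_filter, ← Finset.sum_add_distrib, ← hAc, mul_comm, ← smul_eq_mul]
      refine Finset.sum_le_card_nsmul _ _ _ fun u _ => ?_
      have := hle i u
      split_ifs <;> omega
    have h3 := card_edgesIn_le_sq (G i) A
    rw [hA, sq] at h3
    have := hcon i
    omega
  refine hF (hcopy.extend hS f (Aᶜ \ Finset.univ.biUnion bad) ?_ ?_ Finset.univ ?_ ?_)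
  · have h1 := Finset.le_card_sdiff (Finset.univ.biUnion bad) Aᶜ
    have h2 : (Finset.univ.biUnion bad).card ≤ t * (s * s) := by
      simpa using Finset.card_biUnion_le_card_mul Finset.univ bad (s * s) fun i _ => hbadcard i
    omega
  · intro x hx
    have : f x ∈ A := hf ▸ Finset.mem_map_of_mem f (Finset.mem_univ x)
    simp [this] at hx
  · simpa using le_of_max_le_left ht
  · intro u hu x i _
    have hx : f x ∈ A := hf ▸ Finset.mem_map_of_mem f (Finset.mem_univ x)
    rw [Finset.mem_sdiff] at hu
    have hnb : nbrsIn (G i) A u = A := by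
      refine Finset.eq_of_subset_of_card_le (Finset.filter_subset _ _) ?_
      by_contra! h
      rw [hA] at h
      exact hu.2 (Finset.mem_biUnion.2 ⟨i, Finset.mem_univ i, Finset.mem_filter.2 ⟨hu.1, h⟩⟩)
    rw [← hnb] at hx
    exact (mem_nbrsIn.1 hx).2

/-- The extremal number when no independent vertex cover of `F` has size at most `s`. -/
lemma isRainbowEx_withMatching [Finite W] {F : SimpleGraph W} {s t : ℕ} (hF : NoIndepCover F s)
    (ht : max F.edgeSet.ncard (s + 1) ≤ t) :
    ∃ e : ℕ, IsRainbowEx t s (deleteIndep F) e ∧ ∃ N : ℕ, ∀ n : ℕ, N ≤ n → s ≤ n →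
      IsRainbowEx t n (withMatching F s) (s * (n - s) + e) := by
  have ht' := le_of_max_le_right ht
  obtain ⟨e, he⟩ := exists_isRainbowEx (t := t) (by omega) ⟨_, rainbowFree_bot_deleteIndep hF⟩
  obtain ⟨N, hN⟩ := exists_ncard_edgeSet_le ht he
  refine ⟨e, he, N, fun n hn hsn => ⟨?_, ?_⟩⟩
  · obtain ⟨G₀, hG₀, hG₀e⟩ := he.1
    exact exists_collection_of_deleteIndep le_rfl hsn G₀ hG₀ hG₀e
  · rintro k ⟨G, hG, hk⟩
    obtain ⟨i, hi⟩ := hN (Fin n) (by simpa using hn) G hG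
    rw [Fintype.card_fin] at hi
    exact (hk i).trans hi

/-! ### Independent covers and two-colourings -/

lemma noIndepCover_of_not_isBipartite {F : SimpleGraph W} (hF : ¬ F.IsBipartite) (k : ℕ) :
    NoIndepCover F k := by
  intro S h1 h2
  refine absurd ?_ hF
  let c : F.Coloring Bool := SimpleGraph.Coloring.mk (fun w => decide (w ∈ S)) (by
    intro a b hab h
    by_cases ha : a ∈ S <;> by_cases hb : b ∈ S <;> simp [ha, hb] at h
    · exact h1 ha hb hab.ne hab
    · exact h2 ha hb hab.ne hab)
  simpa using c.colorable

lemma noIndepCover_of_lt_minColorClass {F : SimpleGraph W} {k : ℕ}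
    (hk : k < minColorClass F) : NoIndepCover F k := by
  intro S h1 h2
  refine hk.trans_le (Nat.sInf_le ?_)
  let c : F.Coloring Bool := SimpleGraph.Coloring.mk (fun w => decide (w ∈ S)) (by
    intro a b hab h
    by_cases ha : a ∈ S <;> by_cases hb : b ∈ S <;> simp [ha, hb] at h
    · exact h1 ha hb hab.ne hab
    · exact h2 ha hb hab.ne hab)
  refine ⟨c, ?_⟩
  congr 1
  ext w
  exact (decide_eq_true_iff (p := w ∈ S)).symm

lemma exists_coloring_minColorClass {F : SimpleGraph W} (hF : F.IsBipartite) :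
    ∃ c : F.Coloring Bool, {w | c w = true}.ncard = minColorClass F := by
  have hne : {k : ℕ | ∃ c : F.Coloring Bool, k = {w : W | c w = true}.ncard}.Nonempty := by
    obtain ⟨c⟩ := hF
    exact ⟨_, F.recolorOfEquiv finTwoEquiv c, rfl⟩
  obtain ⟨c, hc⟩ := Nat.sInf_mem hne
  exact ⟨c, hc.symm⟩

/-- There is a star with centre `u` and `p` leaves whose edges have distinct colours from `I`. -/
def HasRainbowStar {V : Type} {t : ℕ} (G : Fin t → SimpleGraph V) (I : Finset (Fin t)) (u : V)
    (p : ℕ) : Prop :=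
  ∃ (b : Fin p ↪ V) (κ : Fin p ↪ Fin t), ∀ j, κ j ∈ I ∧ (G (κ j)).Adj u (b j)

/-! ### Rainbow stars -/

/-- Hall's condition: a set of leaves containing one other than `v₀` sees at least `p` colours, and
`{v₀}` sees at least one. -/
lemma hasRainbowStar_of_hall {t p : ℕ} {G : Fin t → SimpleGraph V} {I : Finset (Fin t)} {u : V}
    {B : Finset V} (hB : B.card = p) {v₀ : V} (h₀ : ∃ i ∈ I, (G i).Adj u v₀)
    (h : ∀ v ∈ B, v ≠ v₀ → p ≤ (I.filter fun i => (G i).Adj u v).card) :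
    HasRainbowStar G I u p := by
  obtain ⟨b, hb⟩ := exists_embedding_map_eq hB
  have hbB : ∀ j, b j ∈ B := fun j => hb ▸ Finset.mem_map_of_mem b (Finset.mem_univ j)
  obtain ⟨κ, hκ, hκI⟩ := (Finset.all_card_le_biUnion_card_iff_exists_injective
    (fun j => I.filter fun i => (G i).Adj u (b j))).1 (by
      intro S
      by_cases hS : ∃ j ∈ S, b j ≠ v₀
      · obtain ⟨j, hj, hne⟩ := hS
        calc S.card ≤ p := by simpa using Finset.card_le_univ S
          _ ≤ _ := h (b j) (hbB j) hne
          _ ≤ _ := Finset.card_le_card (Finset.subset_biUnion_of_mem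
            (fun j => I.filter fun i => (G i).Adj u (b j)) hj)
      · push Not at hS
        rcases S.eq_empty_or_nonempty with rfl | ⟨j, hj⟩
        · simp
        have h1 : S.card ≤ 1 := Finset.card_le_one.2 fun x hx y hy =>
          b.injective ((hS x hx).trans (hS y hy).symm)
        refine h1.trans (Finset.card_pos.2 ?_)
        obtain ⟨i, hi, hadj⟩ := h₀
        exact ⟨i, Finset.mem_biUnion.2 ⟨j, hj, Finset.mem_filter.2 ⟨hi, (hS j hj).symm ▸ hadj⟩⟩⟩)
  exact ⟨b, ⟨κ, hκ⟩, fun j => Finset.mem_filter.1 (hκI j)⟩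

/-- Without a rainbow star of size `q + 1`, a vertex has on average at most `q` neighbours, with
equality only if `q` vertices are neighbours in all colours. -/
lemma sum_card_nbrsIn_le_of_not_hasRainbowStar {t q : ℕ} {G : Fin t → SimpleGraph V}
    {I : Finset (Fin t)} {u : V} (h : ¬ HasRainbowStar G I u (q + 1)) {Z : Finset V}
    (hI : Z.card * q < I.card) :
    ∑ i ∈ I, (nbrsIn (G i) Z u).card ≤ q * I.card ∧
      (∑ i ∈ I, (nbrsIn (G i) Z u).card = q * I.card →
        ∃ H ⊆ Z, H.card = q ∧ ∀ v ∈ H, ∀ i ∈ I, (G i).Adj u v) := by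
  set C : V → Finset (Fin t) := fun v => I.filter fun i => (G i).Adj u v with hC
  have hsum : ∑ i ∈ I, (nbrsIn (G i) Z u).card = ∑ v ∈ Z, (C v).card := by
    simp only [hC, nbrsIn, Finset.card_filter]
    exact Finset.sum_comm
  rw [hsum]
  -- Vertices joined to `u` in at least `q + 1` colours; any `q + 1` of them would be the leaves of
  -- a rainbow star.
  set H : Finset V := Z.filter fun v => q + 1 ≤ (C v).card with hH
  have hHZ : H ⊆ Z := Finset.filter_subset _ _
  have hCI : ∀ v, (C v).card ≤ I.card := fun v => Finset.card_le_card (Finset.filter_subset _ _)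
  have hHq : H.card ≤ q := by
    by_contra! hcon
    obtain ⟨B, hBH, hB⟩ := Finset.exists_subset_card_eq (Nat.succ_le_of_lt hcon)
    obtain ⟨v₀, hv₀⟩ : B.Nonempty := Finset.card_pos.1 (by omega)
    have hbig : ∀ v ∈ B, q + 1 ≤ (C v).card := fun v hv => (Finset.mem_filter.1 (hBH hv)).2
    obtain ⟨i, hi⟩ : (C v₀).Nonempty := Finset.card_pos.1 (by have := hbig v₀ hv₀; omega)
    exact h (hasRainbowStar_of_hall hB ⟨i, Finset.mem_filter.1 hi⟩ fun v hv _ => hbig v hv)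
  have hsplit : ∑ v ∈ Z, (C v).card = ∑ v ∈ H, (C v).card + ∑ v ∈ Z \ H, (C v).card := by
    rw [add_comm, Finset.sum_sdiff hHZ]
  have h1 : ∑ v ∈ H, (C v).card ≤ H.card * I.card := by
    simpa using Finset.sum_le_card_nsmul H (fun v => (C v).card) I.card fun v _ => hCI v
  rcases hHq.lt_or_eq with hlt | heq
  -- A missing element of `H` costs `I.card`, more than the at most `Z.card * q` gained outside `H`;
  -- equality is impossible.
  · have h2 : ∑ v ∈ Z \ H, (C v).card ≤ Z.card * q := by
      refine (Finset.sum_le_card_nsmul _ _ q fun v hv => ?_).trans ?_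
      · rw [Finset.mem_sdiff, hH, Finset.mem_filter, not_and, not_le] at hv
        exact Nat.le_of_lt_succ (hv.2 hv.1)
      · rw [smul_eq_mul]
        exact Nat.mul_le_mul_right _ (Finset.card_le_card Finset.sdiff_subset)
    have h3 : H.card * I.card + I.card ≤ q * I.card := by
      rw [← Nat.succ_mul]
      exact Nat.mul_le_mul_right _ hlt
    constructor
    · omega
    · intro h
      omega
  -- If `H` has `q` elements, a single further coloured neighbour completes a star.
  · have h2 : ∑ v ∈ Z \ H, (C v).card = 0 := by
      refine Finset.sum_eq_zero fun v hv => ?_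
      by_contra hne
      obtain ⟨i, hi⟩ : (C v).Nonempty := Finset.card_pos.1 (Nat.pos_of_ne_zero hne)
      rw [Finset.mem_sdiff] at hv
      refine h (hasRainbowStar_of_hall (B := insert v H)
        (by rw [Finset.card_insert_of_notMem hv.2, heq]) ⟨i, Finset.mem_filter.1 hi⟩ ?_)
      intro w hw hwv
      exact (Finset.mem_filter.1 ((Finset.mem_insert.1 hw).resolve_left hwv)).2
    rw [hsplit, h2, add_zero]
    rw [heq] at h1
    refine ⟨h1, fun h4 => ⟨H, hHZ, heq, fun v hv i hi => ?_⟩⟩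
    have h5 : ∑ v ∈ H, (C v).card = ∑ _v ∈ H, I.card := by
      rw [h4, Finset.sum_const, heq, smul_eq_mul]
    have h6 := (Finset.sum_eq_sum_iff_of_le fun v _ => hCI v).1 h5 v hv
    have h7 : C v = I := Finset.eq_of_subset_of_card_le (Finset.filter_subset _ _) h6.ge
    rw [← h7] at hi
    exact (Finset.mem_filter.1 hi).2

/-! ### The linear bound for bipartite graphs -/

/-- Many stars with the same leaves and all colours distinct yield a rainbow copy of a bipartite
graph. -/
lemma hasRainbowCopy_of_stars [Finite W] {F : SimpleGraph W} (c : F.Coloring Bool) {p t : ℕ}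
    (hp : {w | c w = true}.ncard = p) {G : Fin t → SimpleGraph V} {U : Finset V}
    (hU : Nat.card W ≤ U.card) {b : Fin p → V} (hb : Function.Injective b) (hbU : ∀ j, b j ∉ U)
    {κ : V → Fin p → Fin t} (hadj : ∀ u ∈ U, ∀ j, (G (κ u j)).Adj u (b j))
    (hκ : ∀ u ∈ U, ∀ u' ∈ U, ∀ j j', κ u j = κ u' j' → u = u' ∧ j = j') :
    HasRainbowCopy G F := by
  have := Fintype.ofFinite W
  obtain ⟨g⟩ : Nonempty (W ↪ U) := Function.Embedding.nonempty_of_card_le (by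
    rwa [Fintype.card_coe, ← Nat.card_eq_fintype_card])
  have σ : {w // c w = true} ≃ Fin p := Fintype.equivFinOfCardEq (by
    rw [← hp, ← Nat.card_eq_fintype_card]
    rfl)
  let φ : W → V := fun w => if h : c w = true then b (σ ⟨w, h⟩) else g w
  have hφt : ∀ w (h : c w = true), φ w = b (σ ⟨w, h⟩) := fun w h => dif_pos h
  have hφf : ∀ w, c w = false → φ w = g w := fun w h => dif_neg (by simp [h])
  have hφ : Function.Injective φ := by
    intro w w' hw
    cases h : c w <;> cases h' : c w'
    · rw [hφf w h, hφf w' h'] at hw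
      exact g.injective (Subtype.ext hw)
    · rw [hφf w h, hφt w' h'] at hw
      exact absurd (hw ▸ (g w).2) (hbU _)
    · rw [hφt w h, hφf w' h'] at hw
      exact absurd (hw ▸ (g w').2) (hbU _)
    · rw [hφt w h, hφt w' h'] at hw
      exact congrArg Subtype.val (σ.injective (hb hw))
  have hex : ∀ e : F.edgeSet, ∃ x y, c x = true ∧ c y = false ∧ e.1 = s(x, y) := by
    rintro ⟨e, he⟩
    induction e with | _ x y =>
    have hxy := c.valid he
    cases h : c x <;> cases h' : c y
    · exact absurd (h.trans h'.symm) hxy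
    · exact ⟨y, x, h', h, Sym2.eq_swap⟩
    · exact ⟨x, y, h, h', rfl⟩
    · exact absurd (h.trans h'.symm) hxy
  choose x y hx hy hxy using hex
  refine ⟨⟨φ, hφ⟩, ⟨fun e => κ (g (y e)) (σ ⟨x e, hx e⟩), ?_⟩, ?_⟩
  · intro e e' hee
    obtain ⟨h1, h2⟩ := hκ _ (g _).2 _ (g _).2 _ _ hee
    have h3 := g.injective (Subtype.ext h1)
    have h4 := congrArg Subtype.val (σ.injective h2)
    simp only at h4
    exact Subtype.ext (by rw [hxy, hxy e', h3, h4])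
  · intro e
    have h1 := (hadj _ (g (y e)).2 (σ ⟨x e, hx e⟩)).symm
    have h2 : (G (κ (g (y e)) (σ ⟨x e, hx e⟩))).Adj (φ (x e)) (φ (y e)) := by
      rw [hφt _ (hx e), hφf _ (hy e)]
      exact h1
    rw [hxy e]
    exact h2

/-- In a collection without rainbow copies of a bipartite graph and of a matching, after deleting
boundedly many colours there is a bounded common cover outside of which no vertex is the centre of
a rainbow star. -/
lemma exists_cover_not_hasRainbowStar [Finite W] {F : SimpleGraph W} (c : F.Coloring Bool) {p : ℕ}
    (hp : {w | c w = true}.ncard = p) (s : ℕ) :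
    ∃ K K' : ℕ, ∀ (t : ℕ) (V : Type) (G : Fin t → SimpleGraph V), ¬ HasRainbowCopy G F →
      ¬ HasRainbowCopy G (matching (s + 1)) →
      ∃ (Z : Finset V) (J : Finset (Fin t)), Z.card ≤ K ∧ J.card ≤ K' ∧
        (∀ i ∉ J, Covers (G i) Z) ∧ ∀ u ∉ Z, ¬ HasRainbowStar G Jᶜ u p := by
  -- There are at most `(2 * s) ^ p` leaf tuples in the cover, so among `R` stars more than
  -- `Nat.card W` share theirs.
  set R := (2 * s) ^ p * Nat.card W + 1 with hR
  refine ⟨2 * s + R, s + R * p, ?_⟩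
  intro t V G hF hM
  obtain ⟨J₀, Z, hJ₀, hZ, hcov⟩ := exists_cover_of_no_matching hM
  by_contra! hcon
  have H : ∀ r ≤ R, ∃ (U : Finset V) (b : V → Fin p → V) (κ : V → Fin p → Fin t), U.card = r ∧
      (∀ u ∈ U, u ∉ Z ∧ Function.Injective (b u) ∧
        ∀ j, b u j ∈ Z ∧ κ u j ∉ J₀ ∧ (G (κ u j)).Adj u (b u j)) ∧
      ∀ u ∈ U, ∀ u' ∈ U, ∀ j j', κ u j = κ u' j' → u = u' ∧ j = j' := by
    intro r
    induction r with
    | zero =>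
      intro _
      -- Supplies only default values for the leaves and colours.
      obtain ⟨-, -, b, κ, -⟩ := hcon Z J₀ (by omega) (by omega) hcov
      exact ⟨∅, fun _ => b, fun _ => κ, rfl, by simp, by simp⟩
    | succ r ih =>
      intro hr
      obtain ⟨U, b, κ, hU, h1, h2⟩ := ih (by omega)
      set J₁ : Finset (Fin t) := U.biUnion fun u => Finset.univ.image (κ u) with hJ₁
      -- Adding the old centres to the cover and deleting the old colours forces a new centre and
      -- fresh colours.
      obtain ⟨u, hu, b', κ', hstar⟩ := hcon (Z ∪ U) (J₀ ∪ J₁)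
        ((Finset.card_union_le _ _).trans (by omega)) (by
          refine (Finset.card_union_le _ _).trans (add_le_add hJ₀ ?_)
          refine (Finset.card_biUnion_le_card_mul U _ p fun u _ => ?_).trans
            (Nat.mul_le_mul_right _ (by omega))
          exact Finset.card_image_le.trans (by simp)) (by
          intro i hi a b hab
          rw [Finset.mem_union, not_or] at hi
          exact (hcov i hi.1 a b hab).imp (Finset.mem_union_left _) (Finset.mem_union_left _))
      rw [Finset.mem_union, not_or] at hu
      have hκ' : ∀ j, κ' j ∉ J₀ ∧ κ' j ∉ J₁ := by
        intro j
        have := (hstar j).1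
        rwa [Finset.mem_compl, Finset.mem_union, not_or] at this
      have hnew : ∀ j, ∀ v ∈ U, ∀ j', κ' j ≠ κ v j' := by
        intro j v hv j' h
        refine (hκ' j).2 (Finset.mem_biUnion.2 ⟨v, hv, ?_⟩)
        rw [h]
        exact Finset.mem_image_of_mem _ (Finset.mem_univ _)
      have hne : ∀ v ∈ U, v ≠ u := fun v hv h => hu.2 (h ▸ hv)
      refine ⟨insert u U, Function.update b u b', Function.update κ u κ', ?_, ?_, ?_⟩
      · rw [Finset.card_insert_of_notMem hu.2, hU]
      · intro v hv
        rcases Finset.mem_insert.1 hv with rfl | hv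
        · simp only [Function.update_self]
          refine ⟨hu.1, b'.injective, fun j => ⟨?_, (hκ' j).1, (hstar j).2⟩⟩
          exact (hcov _ (hκ' j).1 _ _ (hstar j).2).resolve_left hu.1
        · simpa only [Function.update_of_ne (hne v hv)] using h1 v hv
      · intro v hv v' hv' j j' hjj
        rcases Finset.mem_insert.1 hv with hvu | hvU <;>
          rcases Finset.mem_insert.1 hv' with hvu' | hvU'
        · subst hvu hvu'
          simp only [Function.update_self] at hjj
          exact ⟨rfl, κ'.injective hjj⟩
        · subst hvu
          rw [Function.update_self, Function.update_of_ne (hne v' hvU')] at hjj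
          exact absurd hjj (hnew _ _ hvU' _)
        · subst hvu'
          rw [Function.update_self, Function.update_of_ne (hne v hvU)] at hjj
          exact absurd hjj.symm (hnew _ _ hvU _)
        · rw [Function.update_of_ne (hne v hvU), Function.update_of_ne (hne v' hvU')] at hjj
          exact h2 v hvU v' hvU' j j' hjj
  obtain ⟨U, b, κ, hU, h1, h2⟩ := H R le_rfl
  obtain ⟨b₀, hb₀, hlt⟩ := Finset.exists_lt_card_fiber_of_mul_lt_card_of_maps_to (s := U)
    (t := Fintype.piFinset fun _ : Fin p => Z) (f := b) (n := Nat.card W)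
    (fun u hu => Fintype.mem_piFinset.2 fun j => ((h1 u hu).2.2 j).1) (by
      rw [Fintype.card_piFinset_const, hU, hR]
      exact Nat.lt_succ_of_le (Nat.mul_le_mul_right _ (Nat.pow_le_pow_left hZ _)))
  have hmem : ∀ u ∈ U.filter (fun u => b u = b₀), u ∈ U ∧ b u = b₀ := fun u hu =>
    Finset.mem_filter.1 hu
  obtain ⟨u₀, hu₀⟩ := Finset.card_pos.1 (Nat.zero_lt_of_lt hlt)
  refine hF (hasRainbowCopy_of_stars c hp hlt.le (b := b₀) (κ := κ) ?_ ?_ ?_ ?_)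
  · rw [← (hmem u₀ hu₀).2]
    exact (h1 u₀ (hmem u₀ hu₀).1).2.1
  · intro j hj
    exact (h1 _ (hmem _ hj).1).1 (Fintype.mem_piFinset.1 hb₀ j)
  · intro u hu j
    have := ((h1 u (hmem u hu).1).2.2 j).2.2
    rwa [(hmem u hu).2] at this
  · intro u hu u' hu'
    exact h2 u (hmem u hu).1 u' (hmem u' hu').1

lemma sum_sum_card_nbrsIn_le [Fintype V] {t q : ℕ} {G : Fin t → SimpleGraph V}
    {I : Finset (Fin t)} {Z : Finset V} (h : ∀ u ∉ Z, ¬ HasRainbowStar G I u (q + 1))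
    (hI : Z.card * q < I.card) :
    ∑ i ∈ I, ∑ u ∈ Zᶜ, (nbrsIn (G i) Z u).card ≤ Zᶜ.card * (q * I.card) := by
  rw [Finset.sum_comm, ← smul_eq_mul]
  exact Finset.sum_le_card_nsmul _ _ _ fun u hu =>
    (sum_card_nbrsIn_le_of_not_hasRainbowStar (h u (Finset.mem_compl.1 hu)) hI).1

/-- Bipartite graphs with a small colour class. -/
lemma exists_ncard_edgeSet_le_linear [Finite W] {F : SimpleGraph W} (c : F.Coloring Bool) {q : ℕ}
    (hq : {w | c w = true}.ncard = q + 1) (s : ℕ) :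
    ∃ t₀ C : ℕ, ∀ t ≥ t₀, ∀ (V : Type) [Fintype V] (G : Fin t → SimpleGraph V),
      RainbowFree G (withMatching F s) →
        ∃ i, (G i).edgeSet.ncard ≤ q * Fintype.card V + C := by
  obtain ⟨K, K', hK⟩ := exists_cover_not_hasRainbowStar c hq s
  -- More than `K * q` colours survive the deletion of `K'`; `K ^ 2` bounds the edges inside the
  -- cover.
  refine ⟨K' + K * q + 1, K ^ 2, ?_⟩
  intro t ht V _ G hfree
  rw [rainbowFree_withMatching] at hfree
  obtain ⟨Z, J, hZ, hJ, hcov, hstar⟩ := hK t V G hfree.1 hfree.2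
  by_contra! hcon
  have hJc : Jᶜ.card = t - J.card := by rw [Finset.card_compl, Fintype.card_fin]
  have hZq : Z.card * q ≤ K * q := Nat.mul_le_mul_right _ hZ
  have h1 := sum_sum_card_nbrsIn_le hstar (show Z.card * q < Jᶜ.card by omega)
  have h2 : ∑ i ∈ Jᶜ, (G i).edgeSet.ncard ≤
      ∑ i ∈ Jᶜ, ∑ u ∈ Zᶜ, (nbrsIn (G i) Z u).card + Jᶜ.card * K ^ 2 := by
    rw [← smul_eq_mul, ← Finset.sum_const, ← Finset.sum_add_distrib]
    refine Finset.sum_le_sum fun i hi => ?_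
    refine (ncard_edgeSet_le_of_covers (hcov i (Finset.mem_compl.1 hi))).trans ?_
    gcongr
    exact (card_edgesIn_le_sq _ _).trans (Nat.pow_le_pow_left hZ 2)
  have h3 : Jᶜ.card * (q * Fintype.card V + K ^ 2) < ∑ i ∈ Jᶜ, (G i).edgeSet.ncard := by
    rw [← smul_eq_mul, ← Finset.sum_const]
    exact Finset.sum_lt_sum_of_nonempty (Finset.card_pos.1 (by omega)) fun i _ => hcon i
  have h4 : Zᶜ.card * (q * Jᶜ.card) ≤ Fintype.card V * (q * Jᶜ.card) :=
    Nat.mul_le_mul_right _ (Finset.card_le_univ _)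
  have h5 : Jᶜ.card * (q * Fintype.card V + K ^ 2) =
      Fintype.card V * (q * Jᶜ.card) + Jᶜ.card * K ^ 2 := by ring
  omega

/-- The extremal number of a bipartite graph with a small colour class is linear up to a constant. -/
lemma exists_isRainbowEx_linear [Finite W] {F : SimpleGraph W} (hF : F.IsBipartite) (hbot : F ≠ ⊥)
    {s : ℕ} (hs : minColorClass F ≤ s) :
    ∃ t₀ C : ℕ, ∀ t : ℕ, max F.edgeSet.ncard (s + 1) ≤ t → t₀ ≤ t →
      ∀ n : ℕ, ∃ e : ℕ, IsRainbowEx t n (withMatching F s) e ∧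
        |(e : ℤ) - ((minColorClass F : ℤ) - 1) * (n : ℤ)| ≤ (C : ℤ) := by
  obtain ⟨c, hc⟩ := exists_coloring_minColorClass hF
  obtain ⟨q, hq⟩ : ∃ q, minColorClass F = q + 1 := by
    refine Nat.exists_eq_succ_of_ne_zero fun h0 => hbot ?_
    rw [h0, Set.ncard_eq_zero] at hc
    rw [SimpleGraph.eq_bot_iff_forall_not_adj]
    intro a b hab
    have hf : ∀ w, c w = false := fun w => by
      have : w ∉ {w | c w = true} := by simp [hc]
      simpa using this
    exact c.valid hab ((hf a).trans (hf b).symm)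
  have hno : NoIndepCover F q := noIndepCover_of_lt_minColorClass (by omega)
  rw [hq] at hc ⊢
  obtain ⟨t₀, C, hC⟩ := exists_ncard_edgeSet_le_linear c hc s
  refine ⟨t₀, C + q * q, fun t ht ht₀ n => ?_⟩
  have ht1 := le_of_max_le_right ht
  have hfree : ∃ G : Fin t → SimpleGraph (Fin n), RainbowFree G (withMatching F s) := by
    refine ⟨fun _ => ⊥, rainbowFree_withMatching.2 ⟨fun h => ?_, fun h => ?_⟩⟩
    · obtain ⟨φ, κ, -, h⟩ := h.exists_coloring
      exact hbot (SimpleGraph.eq_bot_iff_forall_not_adj.2 fun a b hab => h a b hab)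
    · obtain ⟨φ, κ, -, h⟩ := h.exists_coloring
      exact h (0, false) (0, true) ⟨rfl, by simp⟩
  obtain ⟨e, he⟩ := exists_isRainbowEx (by omega) hfree
  refine ⟨e, he, ?_⟩
  have hupper : e ≤ q * n + C := by
    obtain ⟨G, hG, hGe⟩ := he.1
    obtain ⟨i, hi⟩ := hC t ht₀ (Fin n) G hG
    rw [Fintype.card_fin] at hi
    exact (hGe i).trans hi
  have hlower : q * n ≤ e + q * q := by
    rcases le_total q n with h | h
    · have h1 := he.2 (exists_collection_of_deleteIndep (e := 0) (by omega) h _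
        (rainbowFree_bot_deleteIndep hno) fun _ => Nat.zero_le _)
      have h2 : q * (n - q) + q * q = q * n := by rw [← mul_add, Nat.sub_add_cancel h]
      omega
    · have := Nat.mul_le_mul_left q h
      omega
  zify at hupper hlower
  rw [abs_le]
  push_cast
  constructor <;> nlinarith

/-! ### Balanced trees -/

/-- In a tree a neighbour of `x` no farther from `r` must be the penultimate vertex of the path from
`r` to `x`. -/
lemma eq_of_adj_of_dist_le {F : SimpleGraph W} (hF : F.IsTree) {r x a b : W} (ha : F.Adj x a)
    (hb : F.Adj x b) (hda : F.dist r a ≤ F.dist r x) (hdb : F.dist r b ≤ F.dist r x) : a = b := by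
  obtain ⟨p, hp, hpl⟩ := (hF.connected r x).exists_path_of_dist
  have key : ∀ y, F.Adj x y → F.dist r y ≤ F.dist r x → y = p.penultimate := by
    intro y hy hdy
    refine hF.isAcyclic.eq_penultimate_of_adj_end hp hy ?_
    obtain ⟨q, hq, hql⟩ := (hF.connected r y).exists_path_of_dist
    refine hF.isAcyclic.mem_support_of_ne_mem_support_of_adj_of_isPath hp hq hy fun hx => ?_
    have h1 := q.length_takeUntil_lt_length hx hy.ne
    have h2 := SimpleGraph.dist_le (q.takeUntil x hx)
    omega
  rw [key a ha hda, key b hb hdb]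

/-- A tree on at least three vertices has a vertex of degree at least two all of whose neighbours
but one are leaves. -/
lemma exists_adj_forall_leaf [Finite W] {F : SimpleGraph W} (hF : F.IsTree)
    (h3 : 3 ≤ Nat.card W) : ∃ z x₀ w, F.Adj z x₀ ∧ F.Adj z w ∧ w ≠ x₀ ∧
      ∀ x, F.Adj z x → x ≠ x₀ → ∀ q, F.Adj x q → q = z := by
  have := Fintype.ofFinite W
  have := hF.connected.nonempty
  -- At maximal distance, `z` and `x₀` are the two vertices before `w` on the path from `r`. Other
  -- neighbours of `z` are as far from `r` as `w`, so they are leaves.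
  obtain ⟨⟨r, w⟩, hmax⟩ := Finite.exists_max fun x : W × W => F.dist x.1 x.2
  have hmax' : ∀ a b, F.dist a b ≤ F.dist r w := fun a b => hmax (a, b)
  have h2 : 2 ≤ F.dist r w := by
    by_contra! hlt
    obtain ⟨a, -, b, -, c, -, hab, hac, hbc⟩ := Finset.two_lt_card.1 (show 2 < (Finset.univ : Finset W).card
      by rw [Finset.card_univ, ← Nat.card_eq_fintype_card]; omega)
    have hone : ∀ x y, x ≠ y → F.Adj x y := by
      intro x y hxy
      have h1 := hmax' x y
      have h2 := (hF.connected.pos_dist_of_ne hxy)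
      exact SimpleGraph.dist_eq_one_iff_adj.1 (by omega)
    have hle : ∀ x y, x ≠ y → F.dist x y = 1 := fun x y hxy =>
      SimpleGraph.dist_eq_one_iff_adj.2 (hone x y hxy)
    -- In a tree no vertex is equidistant from the ends of an edge.
    exact hF.dist_ne_of_adj a (hone b c hbc) ((hle a b hab).trans (hle a c hac).symm)
  have hparent : ∀ y, y ≠ r → ∃ x, F.Adj y x ∧ F.dist r x + 1 = F.dist r y := by
    intro y hy
    obtain ⟨p, hp, hpl⟩ := (hF.connected r y).exists_path_of_dist
    have hnil : ¬ p.Nil := fun h => hy h.eq.symm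
    have hadj := p.adj_penultimate hnil
    refine ⟨p.penultimate, hadj.symm, ?_⟩
    have h1 := SimpleGraph.dist_le p.dropLast
    have h2 := p.length_dropLast_add_one hnil
    rcases hF.dist_eq_dist_add_one_of_adj r hadj with h | h <;> omega
  obtain ⟨z, hwz, hz⟩ := hparent w (by rintro rfl; simp at h2)
  obtain ⟨x₀, hzx, hx₀⟩ := hparent z (by rintro rfl; simp at hz; omega)
  refine ⟨z, x₀, w, hzx, hwz.symm, by rintro rfl; omega, ?_⟩
  intro x hx hne q hq
  have hlt : F.dist r z < F.dist r x := by
    by_contra! h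
    exact hne (eq_of_adj_of_dist_le hF hx hzx h (by omega))
  refine eq_of_adj_of_dist_le hF hq hx.symm ?_ hlt.le
  have := hmax' r q
  omega

lemma exists_injOn_of_card_le (A : Finset W) (B : Finset V) (y : V) (h : A.card ≤ B.card) :
    ∃ f : W → V, (∀ a ∈ A, f a ∈ B) ∧ ∀ a ∈ A, ∀ a' ∈ A, f a = f a' → a = a' := by
  obtain ⟨g⟩ : Nonempty (A ↪ B) := Function.Embedding.nonempty_of_card_le (by simpa using h)
  refine ⟨fun w => if h : w ∈ A then g ⟨w, h⟩ else y, ?_, ?_⟩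
  · intro a ha
    simp [ha]
  · intro a ha a' ha' haa
    simp only [ha, ha', dif_pos] at haa
    exact congrArg Subtype.val (g.injective (Subtype.ext haa))

/-- Embedding a balanced tree into a complete bipartite graph with small side `H`, extended by a
vertex `y` which has a neighbour in `H` and enough neighbours altogether. -/
lemma exists_embedding_of_center [Fintype W] {F : SimpleGraph W} (c : F.Coloring Bool) {q : ℕ}
    (ht : (Finset.univ.filter fun w => c w = true).card = q + 1)
    (hf : (Finset.univ.filter fun w => c w = false).card = q + 1) {z x₀ w : W}
    (hz : c z = false) (hzx : F.Adj z x₀) (hzw : F.Adj z w) (hwx : w ≠ x₀)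
    (hleaf : ∀ x, F.Adj z x → x ≠ x₀ → ∀ q, F.Adj x q → q = z)
    {Γ : SimpleGraph V} {H U N : Finset V} {y h₀ : V} (hH : H.card = q) (hU : q + 1 ≤ U.card)
    (hHU : Disjoint H U) (hUH : ∀ u ∈ U, ∀ h ∈ H, Γ.Adj u h) (hyH : y ∉ H) (hyU : y ∉ U)
    (hyN : ∀ v ∈ N, Γ.Adj y v) (hNU : Disjoint N U) (hN : q + 1 ≤ N.card) (h₀H : h₀ ∈ H)
    (h₀N : h₀ ∈ N) : ∃ φ : W ↪ V, ∀ a b, F.Adj a b → Γ.Adj (φ a) (φ b) := by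
  set P := Finset.univ.filter fun w => c w = true with hP
  set Q := Finset.univ.filter fun w => c w = false with hQ
  set M := Finset.univ.filter fun x => F.Adj z x with hM
  have hMmem : ∀ {x}, x ∈ M ↔ F.Adj z x := by simp [hM]
  have hMP : M ⊆ P := by
    intro x hx
    have := c.valid (hMmem.1 hx)
    rw [hz] at this
    simpa [hP] using this.symm
  have hx₀M : x₀ ∈ M := hMmem.2 hzx
  have hM2 : 1 < M.card := Finset.one_lt_card.2 ⟨w, hMmem.2 hzw, x₀, hx₀M, hwx⟩
  have hMq : M.card ≤ q + 1 := ht ▸ Finset.card_le_card hMP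
  -- Placing one leaf of `z` at `v` outside `H` is what makes the count work: at most `M.card - 2`
  -- leaves occupy `H`, leaving `q + 1 - M.card` places besides `h₀` for `P \ M`.
  obtain ⟨v, hvN, hvH⟩ := Finset.exists_mem_notMem_of_card_lt_card (show H.card < N.card by omega)
  have hvh : v ≠ h₀ := fun h => hvH (h ▸ h₀H)
  obtain ⟨B, hvB, hBN, hB⟩ := Finset.exists_subsuperset_card_eq
    (s := {v}) (t := N.erase h₀) (n := M.card - 1) (by simp [hvh, hvN]) (by simp; omega)
    (by rw [Finset.card_erase_of_mem h₀N]; omega)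
  rw [Finset.singleton_subset_iff] at hvB
  have hBmem : ∀ b ∈ B, b ≠ h₀ ∧ b ∈ N := fun b hb => Finset.mem_erase.1 (hBN hb)
  obtain ⟨f₁, hf₁, hi₁⟩ := exists_injOn_of_card_le (M.erase x₀) B y (by
    rw [Finset.card_erase_of_mem hx₀M, hB])
  obtain ⟨f₂, hf₂, hi₂⟩ := exists_injOn_of_card_le (P \ M) (H.erase h₀ \ B) y (by
    have h1 := Finset.card_sdiff_add_card_eq_card hMP
    have h2 := Finset.card_sdiff_add_card_inter (H.erase h₀) B
    rw [Finset.card_erase_of_mem h₀H] at h2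
    have h3 : (H.erase h₀ ∩ B).card ≤ (B.erase v).card := by
      refine Finset.card_le_card fun x hx => ?_
      rw [Finset.mem_inter, Finset.mem_erase] at hx
      exact Finset.mem_erase.2 ⟨fun h => hvH (h ▸ hx.1.2), hx.2⟩
    rw [Finset.card_erase_of_mem hvB] at h3
    omega)
  obtain ⟨f₃, hf₃, hi₃⟩ := exists_injOn_of_card_le Q U y (by omega)
  have hQmem : ∀ {x}, x ∈ Q ↔ c x = false := by simp [hQ]
  have hPmem : ∀ {x}, x ∈ P ↔ c x = true := by simp [hP]
  let φ : W → V := fun x => if x = z then y else if x = x₀ then h₀ else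
    if x ∈ M then f₁ x else if x ∈ P then f₂ x else f₃ x
  have hφz : φ z = y := if_pos rfl
  have hzM : z ∉ M := fun h => (hMmem.1 h).ne rfl
  have hneM : ∀ x ∈ M, x ≠ z := fun x hx h => hzM (h ▸ hx)
  have hzP : z ∉ P := by simp [hP, hz]
  have hneP : ∀ x ∈ P, x ≠ z := fun x hx h => hzP (h ▸ hx)
  have hφ0 : φ x₀ = h₀ := by simp [φ, hzx.ne']
  have hφ1 : ∀ x ∈ M.erase x₀, φ x = f₁ x := by
    intro x hx
    rw [Finset.mem_erase] at hx
    simp [φ, hx.1, hx.2, hneM x hx.2]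
  have hφ2 : ∀ x ∈ P \ M, φ x = f₂ x := by
    intro x hx
    rw [Finset.mem_sdiff] at hx
    have : x ≠ x₀ := fun h => hx.2 (h ▸ hx₀M)
    simp [φ, hx.1, hx.2, hneP x hx.1, this]
  have hφ3 : ∀ x ∈ Q, x ≠ z → φ x = f₃ x := by
    intro x hx hxz
    have h1 : x ∉ P := by rw [hPmem, hQmem.1 hx]; simp
    have h2 : x ∉ M := fun h => h1 (hMP h)
    have h3 : x ≠ x₀ := fun h => h2 (h ▸ hx₀M)
    simp [φ, h1, h2, h3, hxz]
  have hcase : ∀ x, x = z ∨ x = x₀ ∨ x ∈ M.erase x₀ ∨ x ∈ P \ M ∨ (x ∈ Q ∧ x ≠ z) := by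
    intro x
    by_cases h1 : x = z
    · exact Or.inl h1
    by_cases h2 : x = x₀
    · exact Or.inr (Or.inl h2)
    by_cases h3 : x ∈ M
    · exact Or.inr (Or.inr (Or.inl (Finset.mem_erase.2 ⟨h2, h3⟩)))
    cases h : c x
    · exact Or.inr (Or.inr (Or.inr (Or.inr ⟨hQmem.2 h, h1⟩)))
    · exact Or.inr (Or.inr (Or.inr (Or.inl (Finset.mem_sdiff.2 ⟨hPmem.2 h, h3⟩))))
  have hyB : ∀ b ∈ B, b ≠ y := fun b hb h => (hyN b (hBmem b hb).2).ne h.symm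
  have hUB : ∀ b ∈ B, b ∉ U := fun b hb h => Finset.disjoint_left.1 hNU (hBmem b hb).2 h
  have hHU' : ∀ b ∈ H, b ∉ U := fun b hb h => Finset.disjoint_left.1 hHU hb h
  have hinj : ∀ a b, φ a = φ b → a = b := by
    intro a b hab
    rcases hcase a with rfl | rfl | ha | ha | ⟨ha, haz⟩ <;>
      rcases hcase b with rfl | rfl | hb | hb | ⟨hb, hbz⟩ <;>
      grind
  refine ⟨⟨φ, fun a b => hinj a b⟩, ?_⟩
  have hmain : ∀ a b, F.Adj a b → c a = true → Γ.Adj (φ a) (φ b) := by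
    intro a b hab ha
    have hb : b ∈ Q := by
      have := c.valid hab
      rw [ha] at this
      simpa [hQ] using this.symm
    rcases eq_or_ne b z with rfl | hbz
    · rw [hφz]
      rcases eq_or_ne a x₀ with rfl | hax
      · rw [hφ0]
        exact (hyN _ h₀N).symm
      · have haM : a ∈ M.erase x₀ := Finset.mem_erase.2 ⟨hax, hMmem.2 hab.symm⟩
        rw [hφ1 a haM]
        exact (hyN _ (hBmem _ (hf₁ a haM)).2).symm
    · rw [hφ3 b hb hbz]
      refine (hUH _ (hf₃ b hb) _ ?_).symm
      rcases eq_or_ne a x₀ with rfl | hax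
      · rwa [hφ0]
      · have haM : a ∉ M := fun h => hbz (hleaf a (hMmem.1 h) hax b hab)
        have haP : a ∈ P \ M := Finset.mem_sdiff.2 ⟨hPmem.2 ha, haM⟩
        rw [hφ2 a haP]
        have := hf₂ a haP
        rw [Finset.mem_sdiff, Finset.mem_erase] at this
        exact this.1.2
  intro a b hab
  cases ha : c a
  · refine (hmain b a hab.symm ?_).symm
    have := c.valid hab
    rw [ha] at this
    simpa using this.symm
  · exact hmain a b hab ha

lemma exists_embedding_of_isTree [Finite W] {F : SimpleGraph W} (hF : F.IsTree)
    (c : F.Coloring Bool) {q : ℕ} (hc : {w | c w = true}.ncard = q + 1)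
    (hW : Nat.card W = 2 * (q + 1))
    {Γ : SimpleGraph V} {H U N : Finset V} {y h₀ : V} (hH : H.card = q) (hU : q + 1 ≤ U.card)
    (hHU : Disjoint H U) (hUH : ∀ u ∈ U, ∀ h ∈ H, Γ.Adj u h) (hyH : y ∉ H) (hyU : y ∉ U)
    (hyN : ∀ v ∈ N, Γ.Adj y v) (hNU : Disjoint N U) (hN : q + 1 ≤ N.card) (h₀H : h₀ ∈ H)
    (h₀N : h₀ ∈ N) : ∃ φ : W ↪ V, ∀ a b, F.Adj a b → Γ.Adj (φ a) (φ b) := by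
  have := Fintype.ofFinite W
  have hqpos : 0 < q := hH ▸ Finset.card_pos.2 ⟨h₀, h₀H⟩
  obtain ⟨z, x₀, w, hzx, hzw, hwx, hleaf⟩ := exists_adj_forall_leaf hF (by omega)
  have ht : (Finset.univ.filter fun w => c w = true).card = q + 1 := by
    rw [← hc, ← Set.ncard_coe_finset]
    simp
  have hf : (Finset.univ.filter fun w => c w = false).card = q + 1 := by
    have := Finset.card_filter_add_card_filter_not (s := (Finset.univ : Finset W))
      (fun w => c w = true)
    rw [ht, Finset.card_univ, ← Nat.card_eq_fintype_card, hW] at this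
    simp only [Bool.not_eq_true] at this
    omega
  cases hz : c z
  · exact exists_embedding_of_center c ht hf hz hzx hzw hwx hleaf hH hU hHU hUH hyH hyU hyN hNU hN
      h₀H h₀N
  · let c' : F.Coloring Bool := SimpleGraph.Coloring.mk (fun w => !c w) (by
      intro a b hab h
      exact c.valid hab (Bool.not_inj h))
    have hc' : ∀ w, c' w = !c w := fun _ => rfl
    refine exists_embedding_of_center c' ?_ ?_ ?_ hzx hzw hwx hleaf hH hU hHU hUH hyH hyU hyN hNU
      hN h₀H h₀N
    · simpa [hc'] using hf
    · simpa [hc'] using ht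
    · simp [hc', hz]

/-- In a graph without a balanced tree satisfying the Erdős–Sós conjecture, few edges inside `Z`
lie outside of the small side `H ⊆ Z` of a complete bipartite graph. -/
lemma card_edgesIn_le_of_isTree [Finite W] [Fintype V] {F : SimpleGraph W} (hF : F.IsTree)
    (c : F.Coloring Bool) {q : ℕ} (hc : {w | c w = true}.ncard = q + 1)
    (hW : Nat.card W = 2 * (q + 1)) (hES : ErdosSosHolds F)
    {Γ : SimpleGraph V} (hΓ : ∀ φ : W ↪ V, ¬ ∀ a b, F.Adj a b → Γ.Adj (φ a) (φ b))
    {Z H U : Finset V} (hHZ : H ⊆ Z) (hH : H.card = q) (hU : q + 1 ≤ U.card)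
    (hZU : Disjoint Z U) (hUH : ∀ u ∈ U, ∀ h ∈ H, Γ.Adj u h) :
    (edgesIn Γ Z).card ≤ (edgesIn Γ H).card + q * (Z.card - q) := by
  set R₁ := (Z \ H).filter fun y => ∃ h ∈ H, Γ.Adj y h with hR₁
  set R₂ := (Z \ H).filter fun y => ¬ ∃ h ∈ H, Γ.Adj y h with hR₂
  have hcard : R₁.card + R₂.card = Z.card - q := by
    rw [hR₁, hR₂, Finset.card_filter_add_card_filter_not, Finset.card_sdiff_of_subset hHZ, hH]
  have hsplit := card_edgesIn_le_of_split Γ Z H R₁ R₂ (by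
    intro a ha b hb hab haR hbR
    have hmem : ∀ x ∈ Z, x ∉ H → x ∉ R₁ → x ∈ R₂ := by
      intro x hx hxH hxR
      have hxZ := Finset.mem_sdiff.2 ⟨hx, hxH⟩
      exact Finset.mem_filter.2 ⟨hxZ, fun h => hxR (Finset.mem_filter.2 ⟨hxZ, h⟩)⟩
    by_cases haH : a ∈ H <;> by_cases hbH : b ∈ H
    · exact Or.inl ⟨haH, hbH⟩
    · exact absurd ⟨a, haH, hab.symm⟩ (Finset.mem_filter.1 (hmem b hb hbH hbR)).2
    · exact absurd ⟨b, hbH, hab⟩ (Finset.mem_filter.1 (hmem a ha haH haR)).2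
    · exact Or.inr ⟨hmem a ha haH haR, hmem b hb hbH hbR⟩)
  have h1 : ∑ y ∈ R₁, (nbrsIn Γ Z y).card ≤ R₁.card * q := by
    refine Finset.sum_le_card_nsmul _ _ _ fun y hy => ?_
    by_contra! hcon
    obtain ⟨hyZ, h₀, h₀H, hyh⟩ := Finset.mem_filter.1 hy
    rw [Finset.mem_sdiff] at hyZ
    obtain ⟨φ, hφ⟩ := exists_embedding_of_isTree hF c hc hW hH hU
      (Finset.disjoint_of_subset_left hHZ hZU) hUH hyZ.2 (Finset.disjoint_left.1 hZU hyZ.1)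
      (N := nbrsIn Γ Z y) (fun v hv => (mem_nbrsIn.1 hv).2)
      (Finset.disjoint_of_subset_left (Finset.filter_subset _ _) hZU) hcon h₀H
      (mem_nbrsIn.2 ⟨hHZ h₀H, hyh⟩)
    exact hΓ φ hφ
  -- Since `|V(F)| = 2 * (q + 1)`, the Erdős–Sós bound is `q` edges per vertex.
  have h2 : (edgesIn Γ R₂).card ≤ R₂.card * q := by
    obtain ⟨f, hf⟩ := exists_embedding_map_eq (A := R₂) rfl
    rw [← hf, card_edgesIn_range, Finset.card_map, Finset.card_univ, Fintype.card_fin]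
    have hfree : F.Free (Γ.comap f) := by
      rintro ⟨ψ⟩
      exact hΓ (ψ.toEmbedding.trans f) fun a b hab => ψ.toHom.map_adj hab
    have h3 := SimpleGraph.card_edgeFinset_le_extremalNumber hfree
    rw [Fintype.card_fin] at h3
    have h4 := hES R₂.card
    rw [hW] at h4
    have h5 : (Γ.comap f).edgeSet.ncard = (Γ.comap f).edgeFinset.card :=
      Set.ncard_eq_toFinset_card' _
    rw [h5]
    refine h3.trans ?_
    have h6 : ((SimpleGraph.extremalNumber R₂.card F : ℕ) : ℝ) ≤ ((R₂.card * q : ℕ) : ℝ) := by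
      refine h4.trans (le_of_eq ?_)
      push_cast
      ring
    exact_mod_cast h6
  rw [← hcard]
  have h3 : q * (R₁.card + R₂.card) = R₁.card * q + R₂.card * q := by ring
  omega

/-! ### The upper bound for balanced trees -/

/-- The graph of the pairs that are adjacent in all graphs with colours in `I`. -/
def commonGraph {t : ℕ} (G : Fin t → SimpleGraph V) (I : Finset (Fin t)) : SimpleGraph V where
  Adj a b := a ≠ b ∧ ∀ i ∈ I, (G i).Adj a b
  symm := ⟨fun _ _ h => ⟨h.1.symm, fun i hi => (h.2 i hi).symm⟩⟩
  loopless := ⟨fun _ h => h.1 rfl⟩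

/-- If all colours induce the same graph on a cover outside of which no rainbow star is centred,
then a large collection in which all graphs are dense has a popular small side `H`. -/
lemma exists_popular_side [Fintype V] {t q K M : ℕ} {G : Fin t → SimpleGraph V}
    {I : Finset (Fin t)} {Z : Finset V} (hZ : Z.card ≤ K) (hI : Z.card * q < I.card)
    (hcov : ∀ i ∈ I, Covers (G i) Z) (hstar : ∀ u ∉ Z, ¬ HasRainbowStar G I u (q + 1))
    (hG : ∀ i ∈ I, q * (Fintype.card V - q) < (G i).edgeSet.ncard)
    (hV : K + t * (K ^ 2 + q * q) + 2 ^ K * M < Fintype.card V) :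
    ∃ H ⊆ Z, H.card = q ∧ ∃ U : Finset V, M ≤ U.card ∧ Disjoint Z U ∧
      ∀ u ∈ U, ∀ h ∈ H, (commonGraph G I).Adj u h := by
  have hstar' := fun u hu => sum_card_nbrsIn_le_of_not_hasRainbowStar (hstar u hu) hI
  set n := Fintype.card V with hn
  set d : V → ℕ := fun u => ∑ i ∈ I, (nbrsIn (G i) Z u).card with hd
  set good := Zᶜ.filter fun u => d u = q * I.card with hgood
  set bad := Zᶜ.filter fun u => ¬ d u = q * I.card with hbad
  have hgb : good.card + bad.card = n - Z.card := by
    rw [hgood, hbad, Finset.card_filter_add_card_filter_not, Finset.card_compl]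
  have hZn : Z.card ≤ n := Finset.card_le_univ Z
  -- Every bad vertex falls short of `q * I.card` by at least one, whereas density allows only a
  -- bounded total shortfall.
  have h1 : ∑ u ∈ Zᶜ, d u + bad.card ≤ (n - Z.card) * (q * I.card) := by
    rw [hbad, Finset.card_filter, ← Finset.sum_add_distrib, ← Finset.card_compl,
      ← smul_eq_mul Zᶜ.card]
    refine Finset.sum_le_card_nsmul _ _ _ fun u hu => ?_
    have h := (hstar' u (Finset.mem_compl.1 hu)).1
    split_ifs with h' <;> simp only [hd] at h' ⊢ <;> omega
  have h2 : ∑ i ∈ I, (G i).edgeSet.ncard ≤ ∑ u ∈ Zᶜ, d u + I.card * K ^ 2 := by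
    rw [hd, Finset.sum_comm, ← smul_eq_mul, ← Finset.sum_const, ← Finset.sum_add_distrib]
    refine Finset.sum_le_sum fun i hi => (ncard_edgeSet_le_of_covers (hcov i hi)).trans ?_
    gcongr
    exact (card_edgesIn_le_sq _ _).trans (Nat.pow_le_pow_left hZ 2)
  have h3 : I.card * (q * (n - q)) ≤ ∑ i ∈ I, (G i).edgeSet.ncard := by
    rw [← smul_eq_mul, ← Finset.sum_const]
    exact Finset.sum_le_sum fun i hi => (hG i hi).le
  have h4 : (n - Z.card) * (q * I.card) ≤ I.card * (q * (n - q)) + I.card * (q * q) := by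
    rw [← mul_add, ← mul_add, mul_left_comm, mul_comm _ I.card, mul_left_comm]
    gcongr
    omega
  have h5 : bad.card ≤ t * (K ^ 2 + q * q) := by
    calc bad.card ≤ I.card * (K ^ 2 + q * q) := by
          rw [mul_add]
          omega
      _ ≤ _ := Nat.mul_le_mul_right _ (by simpa using Finset.card_le_univ I)
  have hex : ∀ u ∈ good, ∃ H ⊆ Z, H.card = q ∧ ∀ v ∈ H, ∀ i ∈ I, (G i).Adj u v := by
    intro u hu
    obtain ⟨huZ, hud⟩ := Finset.mem_filter.1 hu
    exact (hstar' u (Finset.mem_compl.1 huZ)).2 hud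
  choose! S hSZ hSq hS using hex
  obtain ⟨H, hH, hlt⟩ := Finset.exists_lt_card_fiber_of_mul_lt_card_of_maps_to (s := good)
    (t := Z.powerset) (f := S) (n := M) (fun u hu => Finset.mem_powerset.2 (hSZ u hu)) (by
      rw [Finset.card_powerset]
      have : 2 ^ Z.card * M ≤ 2 ^ K * M :=
        Nat.mul_le_mul_right _ (Nat.pow_le_pow_right (by norm_num) hZ)
      omega)
  have hmem : ∀ u ∈ good.filter (fun u => S u = H), u ∈ good ∧ S u = H := fun u hu =>
    Finset.mem_filter.1 hu
  obtain ⟨u₀, hu₀⟩ := Finset.card_pos.1 (Nat.zero_lt_of_lt hlt)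
  have hdisj : ∀ u ∈ good, u ∉ Z := fun u hu =>
    Finset.mem_compl.1 (Finset.mem_filter.1 hu).1
  refine ⟨H, Finset.mem_powerset.1 hH, (hmem u₀ hu₀).2 ▸ hSq u₀ (hmem u₀ hu₀).1, _, hlt.le, ?_, ?_⟩
  · rw [Finset.disjoint_right]
    exact fun u hu => hdisj u (hmem u hu).1
  · intro u hu h hhH
    refine ⟨?_, ?_⟩
    · rintro rfl
      exact hdisj u (hmem u hu).1 (Finset.mem_powerset.1 hH hhH)
    · have := hS u (hmem u hu).1
      rw [(hmem u hu).2] at this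
      exact this h hhH

lemma exists_ncard_edgeSet_le_of_isTree [Finite W] {F : SimpleGraph W} (hF : F.IsTree)
    (c : F.Coloring Bool) {q : ℕ} (hc : {w | c w = true}.ncard = q + 1)
    (hW : Nat.card W = 2 * (q + 1)) (hES : ErdosSosHolds F) (s : ℕ) :
    ∃ t₀ : ℕ, ∀ t ≥ t₀, ∀ e, IsRainbowEx t q (deleteIndep F) e →
      ∃ N : ℕ, ∀ (V : Type) [Fintype V], N ≤ Fintype.card V → ∀ G : Fin t → SimpleGraph V,
        RainbowFree G (withMatching F s) →
          ∃ i, (G i).edgeSet.ncard ≤ q * (Fintype.card V - q) + e := by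
  obtain ⟨K, K', hK⟩ := exists_cover_not_hasRainbowStar c hc s
  -- More than `m₀` colours exceed both `|E(F)|`, making a copy in the common graph rainbow, and
  -- `Z.card * q`, as the star bound requires. There are at most `2 ^ (K * K)` patterns on `Z`.
  set m₀ := F.edgeSet.ncard + K * q with hm₀
  refine ⟨K' + 2 ^ (K * K) * m₀ + 1 + F.edgeSet.ncard, fun t ht e he => ?_⟩
  refine ⟨K + t * (K ^ 2 + q * q) + 2 ^ K * Nat.card W + 1, fun V _ hV G hfree => ?_⟩
  rw [rainbowFree_withMatching] at hfree
  obtain ⟨Z, J, hZ, hJ, hcov, hstar⟩ := hK t V G hfree.1 hfree.2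
  by_contra! hcon
  have hJc : Jᶜ.card = t - J.card := by rw [Finset.card_compl, Fintype.card_fin]
  let type : Fin t → Finset (V × V) := fun i => (Z ×ˢ Z).filter fun x => (G i).Adj x.1 x.2
  obtain ⟨T, -, hlt⟩ := Finset.exists_lt_card_fiber_of_mul_lt_card_of_maps_to (s := Jᶜ)
    (t := (Z ×ˢ Z).powerset) (f := type) (n := m₀)
    (fun i _ => Finset.mem_powerset.2 (Finset.filter_subset _ _)) (by
      rw [Finset.card_powerset, Finset.card_product]
      have : 2 ^ (Z.card * Z.card) * m₀ ≤ 2 ^ (K * K) * m₀ :=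
        Nat.mul_le_mul_right _ (Nat.pow_le_pow_right (by norm_num) (Nat.mul_le_mul hZ hZ))
      omega)
  set I := Jᶜ.filter fun i => type i = T with hI
  have hIJ : ∀ i ∈ I, i ∉ J := fun i hi => Finset.mem_compl.1 (Finset.mem_filter.1 hi).1
  have hstar' : ∀ u ∉ Z, ¬ HasRainbowStar G I u (q + 1) := by
    rintro u hu ⟨b, κ, h⟩
    exact hstar u hu ⟨b, κ, fun j => ⟨(Finset.mem_filter.1 (h j).1).1, (h j).2⟩⟩
  have hZq : Z.card * q < I.card := by
    have := Nat.mul_le_mul_right q hZ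
    omega
  obtain ⟨H, hHZ, hH, U, hU, hZU, hUH⟩ := exists_popular_side (M := Nat.card W) hZ hZq
    (fun i hi => hcov i (hIJ i hi)) hstar'
    (fun i _ => (Nat.le_add_right _ e).trans_lt (hcon i)) hV
  set Γ := commonGraph G I with hΓdef
  have hΓ : ∀ φ : W ↪ V, ¬ ∀ a b, F.Adj a b → Γ.Adj (φ a) (φ b) := fun φ hφ =>
    hfree.1 (hasRainbowCopy_of_monochromatic φ I (by omega) fun a b hab => (hφ a b hab).2)
  have hsame : ∀ i ∈ I, edgesIn (G i) Z = edgesIn Γ Z := by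
    intro i hi
    ext x
    induction x with | _ a b =>
    rw [mk_mem_edgesIn, mk_mem_edgesIn]
    refine and_congr_left fun hab => ⟨fun h => ⟨h.ne, fun j hj => ?_⟩, fun h => h.2 i hi⟩
    have h1 : (a, b) ∈ type i :=
      Finset.mem_filter.2 ⟨Finset.mem_product.2 hab, h⟩
    rw [(Finset.mem_filter.1 hi).2, ← (Finset.mem_filter.1 hj).2] at h1
    exact (Finset.mem_filter.1 h1).2
  have hcore := card_edgesIn_le_of_isTree hF c hc hW hES hΓ hHZ hH (by omega) hZU hUH
  -- The constant collection `Γ` is tested: a forbidden graph inside `H` would extend through `U` to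
  -- a copy of `F` in `Γ`.
  have hside : (edgesIn Γ H).card ≤ e := by
    obtain ⟨f, hf⟩ := exists_embedding_map_eq hH
    have hfH : ∀ x, f x ∈ H := fun x => hf ▸ Finset.mem_map_of_mem f (Finset.mem_univ x)
    refine he.2 ⟨fun _ => Γ.comap f, ?_, fun _ => ?_⟩
    · rw [rainbowFree_deleteIndep]
      intro S hS hcopy
      have hcopy' := HasRainbowCopy.extend (G := fun _ : Fin t => Γ) hS f hcopy U hU
        (fun x => Finset.disjoint_left.1 hZU (hHZ (hfH x))) Finset.univ
        (by rw [Finset.card_univ, Fintype.card_fin]; omega) fun u hu x _ _ => hUH u hu _ (hfH x)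
      obtain ⟨φ, κ, -, hφ⟩ := hcopy'.exists_coloring
      exact hΓ φ hφ
    · rw [← card_edgesIn_range, hf]
  have hqZ : q ≤ Z.card := hH ▸ Finset.card_le_card hHZ
  have hZn : Z.card ≤ Fintype.card V := Finset.card_le_univ Z
  have h1 := sum_sum_card_nbrsIn_le hstar' hZq
  have h2 : ∑ i ∈ I, (G i).edgeSet.ncard ≤
      ∑ i ∈ I, ∑ u ∈ Zᶜ, (nbrsIn (G i) Z u).card + I.card * (edgesIn Γ Z).card := by
    rw [← smul_eq_mul, ← Finset.sum_const, ← Finset.sum_add_distrib]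
    refine Finset.sum_le_sum fun i hi => ?_
    rw [← hsame i hi]
    exact ncard_edgeSet_le_of_covers (hcov i (hIJ i hi))
  have h3 : I.card * (q * (Fintype.card V - q) + e) < ∑ i ∈ I, (G i).edgeSet.ncard := by
    rw [← smul_eq_mul, ← Finset.sum_const]
    exact Finset.sum_lt_sum_of_nonempty (Finset.card_pos.1 (by omega)) fun i _ => hcon i
  have h4 : I.card * (edgesIn Γ Z).card ≤ I.card * (e + q * (Z.card - q)) :=
    Nat.mul_le_mul_left _ (by omega)
  rw [Finset.card_compl] at h1
  have h5 : Fintype.card V - q = (Fintype.card V - Z.card) + (Z.card - q) := by omega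
  have h6 : I.card * (q * (Fintype.card V - q) + e) =
      (Fintype.card V - Z.card) * (q * I.card) + I.card * (e + q * (Z.card - q)) := by
    rw [h5]
    ring
  omega

/-- The extremal number of a balanced tree satisfying the Erdős–Sós conjecture. -/
lemma exists_isRainbowEx_of_isTree [Finite W] {F : SimpleGraph W} (hF : F.IsTree)
    (hW : Nat.card W = 2 * minColorClass F) (hES : ErdosSosHolds F) {s : ℕ}
    (hs : minColorClass F ≤ s) :
    ∃ t₀ : ℕ, ∀ t : ℕ, max F.edgeSet.ncard (s + 1) ≤ t → t₀ ≤ t →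
      ∃ e : ℕ, IsRainbowEx t (minColorClass F - 1) (deleteIndep F) e ∧
        ∃ N : ℕ, ∀ n : ℕ, N ≤ n → minColorClass F ≤ n →
          IsRainbowEx t n (withMatching F s)
            ((minColorClass F - 1) * (n - minColorClass F + 1) + e) := by
  obtain ⟨c, hc⟩ := exists_coloring_minColorClass hF.isBipartite
  obtain ⟨q, hq⟩ : ∃ q, minColorClass F = q + 1 := by
    refine Nat.exists_eq_succ_of_ne_zero fun h0 => ?_
    have := hF.connected.nonempty
    have := Nat.card_pos (α := W)
    omega
  have hno : NoIndepCover F q := noIndepCover_of_lt_minColorClass (by omega)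
  rw [hq] at hc hW hs ⊢
  obtain ⟨t₀, ht₀⟩ := exists_ncard_edgeSet_le_of_isTree hF c hc hW hES s
  refine ⟨t₀, fun t ht htt => ?_⟩
  have ht' := le_of_max_le_right ht
  rw [Nat.add_sub_cancel]
  obtain ⟨e, he⟩ := exists_isRainbowEx (t := t) (by omega) ⟨_, rainbowFree_bot_deleteIndep hno⟩
  obtain ⟨N, hN⟩ := ht₀ t htt e he
  refine ⟨e, he, N, fun n hn hqn => ?_⟩
  rw [show n - (q + 1) + 1 = n - q by omega]
  constructor
  · obtain ⟨G₀, hG₀, hG₀e⟩ := he.1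
    exact exists_collection_of_deleteIndep (by omega) (by omega) G₀ hG₀ hG₀e
  · rintro k ⟨G, hG, hk⟩
    obtain ⟨i, hi⟩ := hN (Fin n) (by simpa using hn) G hG
    rw [Fintype.card_fin] at hi
    exact (hk i).trans hi

end
end RainbowTuran

theorem theorem1 {W : Type} [Finite W] (F : SimpleGraph W) (s : ℕ) :
    -- (i)
    (¬ F.IsBipartite →
      ∀ t : ℕ, max F.edgeSet.ncard (s + 1) ≤ t →
        ∃ e : ℕ, RainbowTuran.IsRainbowEx t s (RainbowTuran.deleteIndep F) e ∧
          ∃ N : ℕ, ∀ n : ℕ, N ≤ n → s ≤ n →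
            RainbowTuran.IsRainbowEx t n (RainbowTuran.withMatching F s) (s * (n - s) + e)) ∧
    -- (ii)
    (F.IsBipartite → s < RainbowTuran.minColorClass F →
      ∀ t : ℕ, max F.edgeSet.ncard (s + 1) ≤ t →
        ∃ e : ℕ, RainbowTuran.IsRainbowEx t s (RainbowTuran.coverFamily F s) e ∧
          ∃ N : ℕ, ∀ n : ℕ, N ≤ n → s ≤ n →
            RainbowTuran.IsRainbowEx t n (RainbowTuran.withMatching F s) (s * (n - s) + e)) ∧
    -- (iii)
    (F.IsBipartite → F ≠ ⊥ → RainbowTuran.minColorClass F ≤ s →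
      ∃ t₀ C : ℕ, ∀ t : ℕ, max F.edgeSet.ncard (s + 1) ≤ t → t₀ ≤ t →
        ∀ n : ℕ, ∃ e : ℕ, RainbowTuran.IsRainbowEx t n (RainbowTuran.withMatching F s) e ∧
          |(e : ℤ) - ((RainbowTuran.minColorClass F : ℤ) - 1) * (n : ℤ)| ≤ (C : ℤ)) ∧
    -- (iv)
    (F.IsTree → Nat.card W = 2 * RainbowTuran.minColorClass F →
      RainbowTuran.ErdosSosHolds F → RainbowTuran.minColorClass F ≤ s →
      ∃ t₀ : ℕ, ∀ t : ℕ, max F.edgeSet.ncard (s + 1) ≤ t → t₀ ≤ t →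
        ∃ e : ℕ,
          RainbowTuran.IsRainbowEx t (RainbowTuran.minColorClass F - 1)
            (RainbowTuran.coverFamily F (RainbowTuran.minColorClass F - 1)) e ∧
          ∃ N : ℕ, ∀ n : ℕ, N ≤ n → RainbowTuran.minColorClass F ≤ n →
            RainbowTuran.IsRainbowEx t n (RainbowTuran.withMatching F s)
              ((RainbowTuran.minColorClass F - 1) * (n - RainbowTuran.minColorClass F + 1) + e)) := by
  refine ⟨fun hF t ht => ?_, fun _ hs t ht => ?_, fun hF hbot hs => ?_, fun hF hW hES hs => ?_⟩
  · exact RainbowTuran.isRainbowEx_withMatching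
      (RainbowTuran.noIndepCover_of_not_isBipartite hF s) ht
  · simp only [RainbowTuran.isRainbowEx_coverFamily]
    exact RainbowTuran.isRainbowEx_withMatching
      (RainbowTuran.noIndepCover_of_lt_minColorClass hs) ht
  · exact RainbowTuran.exists_isRainbowEx_linear hF hbot hs
  · simp only [RainbowTuran.isRainbowEx_coverFamily]
    exact RainbowTuran.exists_isRainbowEx_of_isTree hF hW hES hs
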